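/- Let $p=(p_1,p_2,\dots)$ be a probability distribution on $\mathbb{N}_+=\{1,2,\dots\}$ with finite mean $\mu=\sum_n n p_n<\infty$. Let $\Pi$ be a random permutation of $\mathbb{N}_+$ that is the concatenation of blocks Block$_0$, Block$_1$, Block$_2,\dots$ with lengths $T_0,Y_1,Y_2,\dots$, where $T_0\in\{0,1,2,\dots\}$ (zero delay means $T_0=0$), the $Y_i$ are i.i.d. with law $p$ and independent of $T_0$, and, given all block lengths, the reduced permutations of the blocks $i\ge 1$ are independent and uniform on the symmetric groups $\mathfrak{S}_{Y_i}$ (nothing is assumed on how $\Pi$ permutes Block$_0$). Put $T_k=T_0+Y_1+\dots+Y_k$, so that Block$_k$ is $\{T_{k-1}+1,\dots,T_k\}$ for $k\ge1$; say that $\Pi$ has a renewal at $n$ if $n=T_k$ for some $k\ge 0$. Let $D_n=\Pi_n-n$. (i) For $j\ge1$, let $\nu_j$ be the expected number of cycles of $\Pi$ of length $j$ in Block$_k$; for each $k\ge1$, $$\nu_j=\frac1j\,\mathbb{P}(Y_1\ge j),\qquad \mathbb{P}(Y_1\ge j)=\sum_{i\ge j}p_i .$$ If $C_{n,j}$ is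 the number of cycles of length $j$ wholly contained in $\{1,\dots,n\}$, then $C_{n,j}/n\to\nu_j/\mu$ almost surely. The almost sure limit as $n\to\infty$ of the number $C_{n,j}$ relative to the number of cycles of all lengths wholly contained in $\{1,\dots,n\}$ is $$p^\circ_j=\frac{\sum_{i\ge j}p_i}{j\sum_{i\ge1}p_iH_i},\qquad H_i=\sum_{k=1}^i\frac1k,$$ the sum $\sum_i p_iH_i$ being finite. In (ii) and (iii) assume moreover that $p$ is aperiodic, i.e. $\gcd\{n:p_n>0\}=1$. Let $\Pi^*$ be a stationary version of $\Pi$ on $\mathbb{Z}$: a random permutation of $\mathbb{Z}$ with a random set of renewal times in $\mathbb{Z}$, each of which is almost surely a splitting time ($\Pi^*$ maps $(-\infty,z]$ onto itself), such that displacements $D^*_z=\Pi^*_z-z$ and renewal indicators $R^*_z$ are jointly stationary, $\mathbb{P}(R^*_z=1)=1/\mu$, and, given a renewal at $z$, the sequence $(\Pi^*_{z+i}-z,\,R^*_{z+i})_{i\ge1}$ has the law of the corresponding sequence of $\Pi$ given a renewal at $n$, whenever the latter has positive probability. (ii) For every $d\in\mathbb{Z}$ and $z\in\mathbb{Z}$,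 $$\lim_{n\to\infty}\mathbb{P}(D_n=d)=\mathbb{P}(D^*_z=d)=\frac1\mu\,\mathbb{E}\left(\frac{(Y_1-|d|)_+}{Y_1}\right),$$ which is a probability distribution on $\mathbb{Z}$ symmetric about $0$, and $$\lim_{n\to\infty}\mathbb{P}(\Pi_n>n)=\mathbb{P}(D^*_z>0)=\frac12\left(1-\frac1\mu\right),$$ and the same holds with $<$ instead of $>$. (iii) For real $r>0$ let $\sigma_r(n)=\sum_{k=1}^n k^r$ and $\delta_r(n)=\sigma_r(n)-n^{-1}\sigma_{r+1}(n)$. In $[0,\infty]$, for every $z\in\mathbb{Z}$, $$\mathbb{E}|D^*_z|^r=\frac2\mu\,\mathbb{E}\,\delta_r(Y_1),$$ and, provided $\mathbb{E}\,T_0^r<\infty$ (in particular for zero delay), also $\lim_{n\to\infty}\mathbb{E}|D_n|^r=\frac2\mu\,\mathbb{E}\,\delta_r(Y_1)$. This value is finite, i.e. the limit distribution of displacements has a finite absolute moment of order $r$, if and only if $\mathbb{E}\,Y_1^{r+1}<\infty$. For integers $r\ge1$, $\delta_r(n)$ is a polynomial in $n$ of degree $r+1$; $\delta_1(n)=\frac16(n^2-1)$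 and $\delta_2(n)=\frac1{12}n(n^2-1)$ for all $n\ge1$. -/

import Mathlib

open MeasureTheory ProbabilityTheory Filter Topology
open scoped ENNReal

noncomputable section

namespace RegenPerm

/-- A permutation `f` of `ℕ+ = {1, 2, …}` splits at `n ∈ {0, 1, 2, …}`: it maps `{1, …, n}` onto itself. -/
def SplitsAt (f : Equiv.Perm ℕ+) (n : ℕ) : Prop :=
  ∀ i : ℕ+, (f i : ℕ) ≤ n ↔ (i : ℕ) ≤ n

/-- A permutation `f` of `ℤ` splits at `z`: it maps `(-∞, z]` onto itself. -/
def SplitsAtInt (f : Equiv.Perm ℤ) (z : ℤ) : Prop :=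
  ∀ i : ℤ, f i ≤ z ↔ i ≤ z

/-- The reduced block of `f` on `{t + 1, …, t + n}` is `σ`. Here `σ` is a permutation of
`Fin n = {0, …, n - 1}`, which stands for `{1, …, n}`. -/
def ReducedBlockIs (f : Equiv.Perm ℕ+) (t n : ℕ) (σ : Equiv.Perm (Fin n)) : Prop :=
  ∀ j : Fin n, f (Nat.succPNat (t + j)) = Nat.succPNat (t + σ j)

/-- The delayed renewal process `T_k = T₀ + Y_1 + ⋯ + Y_k`. The `i`-th block length `Y_i`, `i ≥ 1`, is
`Y (i - 1)`; the corresponding block is `{T_{i-1} + 1, …, T_i}`. -/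
def renewalTime {Ω : Type*} (T₀ : Ω → ℕ) (Y : ℕ → Ω → ℕ+) (k : ℕ) (ω : Ω) : ℕ :=
  T₀ ω + ∑ i ∈ Finset.range k, (Y i ω : ℕ)

/-- There is a renewal at `n`, i.e. `R_n = 1`. -/
def RenewalAt {Ω : Type*} (T₀ : Ω → ℕ) (Y : ℕ → Ω → ℕ+) (n : ℕ) (ω : Ω) : Prop :=
  ∃ k, renewalTime T₀ Y k ω = n

/-- `Per` is a recurrent regenerative random permutation of `ℕ+` with block length distribution `p`
and blocks governed by `Q`: it is the concatenation of a block of almost surely finite length `T₀` (zero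
delay means `T₀ = 0`), on which nothing is assumed, and of blocks of lengths `Y_1, Y_2, …`, where
the `Y_i` are i.i.d. with law `p` and independent of `T₀`, and where, given all the block lengths,
the reduced blocks with index `i ≥ 1` are independent with laws `Q (Y_i)`. -/
structure IsRecurrentRegenerative {Ω : Type*} [MeasurableSpace Ω] (P : Measure Ω)
    (Per : Ω → Equiv.Perm ℕ+) (T₀ : Ω → ℕ) (Y : ℕ → Ω → ℕ+)
    (p : PMF ℕ+) (Q : ∀ n : ℕ+, PMF (Equiv.Perm (Fin n))) : Prop where
  measurable_perm : ∀ i, Measurable fun ω => (Per ω i : ℕ)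
  measurable_delay : Measurable T₀
  measurable_length : ∀ i, Measurable fun ω => (Y i ω : ℕ)
  splits : ∀ᵐ ω ∂P, ∀ k, SplitsAt (Per ω) (renewalTime T₀ Y k ω)
  law_length : ∀ i n, P {ω | Y i ω = n} = p n
  indep_length : iIndepFun (fun i ω => (Y i ω : ℕ)) P
  indep_delay : IndepFun T₀ (fun ω i => (Y i ω : ℕ)) P
  law_blocks : ∀ (m t : ℕ) (n : Fin m → ℕ+) (σ : ∀ i, Equiv.Perm (Fin (n i))),
    P {ω | T₀ ω = t ∧ ∀ i : Fin m, Y i ω = n i ∧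
        ReducedBlockIs (Per ω) (renewalTime T₀ Y i ω) (n i) (σ i)} =
      P {ω | T₀ ω = t ∧ ∀ i : Fin m, Y i ω = n i} * ∏ i, Q (n i) (σ i)

/-- The mean block length `μ = ∑ n p_n`, in `[0, ∞]`. -/
def meanLength (p : PMF ℕ+) : ℝ≥0∞ := ∑' n : ℕ+, (n : ℝ≥0∞) * p n

/-- `p` is aperiodic: `gcd {n : p_n > 0} = 1`. -/
def Aperiodic (p : PMF ℕ+) : Prop :=
  ∀ d : ℕ, (∀ n : ℕ+, p n ≠ 0 → d ∣ (n : ℕ)) → d = 1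

/-- `StarPer`, a random permutation of `ℤ` with random set of renewal times `Ren ⊆ ℤ`, is a stationary
version of the regenerative permutation `Per` of `ℕ+`: renewal times are splitting times, displacements
and renewal indicators are jointly stationary, a renewal at `z` has probability `1 / μ`, and, given a
renewal at `z`, the residual permutation `StarPer_{z+i} - z` and the residual
renewal indicators, `i ≥ 1`, have jointly the same law as those of `Per` given a renewal at `n`, for
each `n` at which `Per` has a renewal with positive probability. (`i.natPred` is `i - 1`, so
`Nat.succPNat (n + i.natPred)` is `n + i` as an element of `ℕ+`.) -/
structure IsStationaryVersion {Ω Ω' : Type*} [MeasurableSpace Ω] [MeasurableSpace Ω']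
    (P : Measure Ω) (Per : Ω → Equiv.Perm ℕ+) (T₀ : Ω → ℕ) (Y : ℕ → Ω → ℕ+) (p : PMF ℕ+)
    (P' : Measure Ω') (StarPer : Ω' → Equiv.Perm ℤ) (Ren : Ω' → Set ℤ) : Prop where
  measurable_perm : ∀ z, Measurable fun ω => StarPer ω z
  measurable_renewal : ∀ z, MeasurableSet {ω | z ∈ Ren ω}
  splits : ∀ᵐ ω ∂P', ∀ z ∈ Ren ω, SplitsAtInt (StarPer ω) z
  stationary : ∀ a : ℤ,
    P'.map (fun ω (z : ℤ) => (StarPer ω (a + z) - (a + z), a + z ∈ Ren ω)) =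
      P'.map (fun ω (z : ℤ) => (StarPer ω z - z, z ∈ Ren ω))
  renewal_prob : ∀ z, P' {ω | z ∈ Ren ω} = (meanLength p)⁻¹
  regenerative : ∀ (z : ℤ) (n : ℕ), P {ω | RenewalAt T₀ Y n ω} ≠ 0 →
    (P'[|{ω | z ∈ Ren ω}]).map
        (fun ω (i : ℕ+) => (StarPer ω (z + ((i : ℕ) : ℤ)) - z, z + ((i : ℕ) : ℤ) ∈ Ren ω)) =
      (P[|{ω | RenewalAt T₀ Y n ω}]).map
        (fun ω (i : ℕ+) => (((Per ω (Nat.succPNat (n + i.natPred)) : ℕ) : ℤ) - (n : ℤ),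
          RenewalAt T₀ Y (n + (i : ℕ)) ω))

/-- `C` is (the set of elements of) a cycle of `f`; fixed points are cycles of length one. -/
def IsCycleSet (f : Equiv.Perm ℕ+) (C : Set ℕ+) : Prop :=
  ∃ x, C = {y | f.SameCycle x y}

/-- The number of cycles of `f` of length `j` that are wholly contained in `{a + 1, …, b}`. -/
def cycleCount (f : Equiv.Perm ℕ+) (a b j : ℕ) : ℕ :=
  Set.ncard {C : Set ℕ+ | IsCycleSet f C ∧ C.ncard = j ∧ ∀ y ∈ C, a < (y : ℕ) ∧ (y : ℕ) ≤ b}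

/-- The number of cycles of `f`, of any length, that are wholly contained in `{a + 1, …, b}`. -/
def totalCycleCount (f : Equiv.Perm ℕ+) (a b : ℕ) : ℕ :=
  Set.ncard {C : Set ℕ+ | IsCycleSet f C ∧ ∀ y ∈ C, a < (y : ℕ) ∧ (y : ℕ) ≤ b}

/-- The displacement `D_n = f(n) - n`. -/
def displacement (f : Equiv.Perm ℕ+) (n : ℕ+) : ℤ := ((f n : ℕ) : ℤ) - ((n : ℕ) : ℤ)

/-- `σ_r(n) = 1^r + ⋯ + n^r`, for real `r`. -/
def powerSum (r : ℝ) (n : ℕ) : ℝ := ∑ k ∈ Finset.Icc 1 n, (k : ℝ) ^ r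

/-- `δ_r(n) = σ_r(n) - σ_{r+1}(n) / n`. -/
def deltaFun (r : ℝ) (n : ℕ+) : ℝ := powerSum r n - powerSum (r + 1) n / (n : ℝ)

end RegenPerm

end

/-!
Cycles and displacements after the delay are determined block by block, and the blocks are independent and
identically distributed; this gives the cycle counts by the law of large numbers and the displacements by the
renewal theorem.

*Blocks.* The block with index `k` is encoded as an element `block Per T₀ Y k ω` of the countable type of
pairs (length, reduced permutation). The joint law of the delay and of finitely many blocks is a product
on singletons, so that each block is independent of the delay and of all earlier blocks
(`indepFun_past_block`) and all blocks have the same law (`identDistrib_block`).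

*Cycles.* The number of cycles inside a block is the sum over its points of the reciprocal of the length of the
cycle through the point (`ncard_cyclesIn_block`). In a uniform permutation of `n` points the expected number of
points in cycles of length `j ≤ n` is one (`sum_card_minimalPeriod`): such points correspond to embeddings of
`Fin j` which intertwine the rotation with the permutation, and by transitivity of the symmetric group on
embeddings each embedding is intertwined equally often. Hence the means `P(Y ≥ j) / j` and
`E H_Y`. The almost sure limits follow from the strong law of large numbers along renewal times, by monotonicity
in between (`tendsto_div_of_tendsto_subsequence`).

*Displacements.* Splitting according to the last renewal `m < n` before `n` gives
`E φ(D_n) = ∑_{m < n} u_m g(n - m)`, up to the event that `n` lies in the delay block; here `u_m` is the probability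
of a renewal at `m` and `g(i)` is the mean of `φ` at the displacement of the `i`-th point of a block, on the event that
the block has such a point (`lintegral_displacement_eq_sum`). For `φ = 1` this is the identity
`P(T₀ < n) = ∑_{m < n} u_m P(Y ≥ n - m)`, from which the renewal theorem `u_m → 1 / μ` is proved by
passing to limits along ultrafilters and applying a maximum principle (`renewal_limit`). For general `φ ≥ 0` the
sum then converges to `∑_i g(i) / μ`, by dominated convergence or Fatou's lemma (`tendsto_convolution`), and
`∑_i g(i) = E[Y⁻¹ ∑_{a, b ≤ Y} φ(b - a)]` (`tsum_lintegral_blockDisp`). In the stationary version the same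
decomposition holds with `1 / μ` in place of `u_m`, and no limit is needed
(`IsStationaryVersion.lintegral_displacement`). The choices of `φ` as an indicator and as `|x| ^ r` give all the
stated limits; for the latter `∑_{a, b ≤ n} |b - a| ^ r = 2 n δ_r(n)`, and `δ_r(n)` lies between multiples of `n ^ (r + 1)`
for `n ≥ 2` (`rpow_le_deltaFun`, `deltaFun_le`).
-/

namespace RegenPerm

/-! ### The renewal theorem -/

/-- Maximum principle for the equation `w k = ∑ q_i w (k + 1 + i)` with weights `q_i` on step
lengths `i + 1` of greatest common divisor one: the maximum spreads along all steps, hence along the numerical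
semigroup which they generate, which contains all large integers. -/
theorem eventually_eq_of_averaging {q w : ℕ → ℝ} (hq : ∀ i, 0 ≤ q i) (hq1 : HasSum q 1)
    (hap : ∀ d : ℕ, (∀ i, q i ≠ 0 → d ∣ i + 1) → d = 1)
    (hw : ∀ k, HasSum (fun i => q i * w (k + 1 + i)) (w k)) (hle : ∀ k, w k ≤ w 0) :
    ∃ N, ∀ m, N ≤ m → w m = w 0 := by
  have step : ∀ k, w k = w 0 → ∀ i, q i ≠ 0 → w (k + (i + 1)) = w 0 := by
    intro k hk i hi
    -- The average `w k` of values `≤ w 0` attains `w 0`, so each value with positive weight does.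
    have h := (hq1.mul_right (w 0)).sub (hw k)
    rw [hk, one_mul, sub_self] at h
    have h' := (hasSum_zero_iff_of_nonneg (fun i => ?_)).1 h
    · have h2 := congrFun h' i
      simp only [Pi.zero_apply] at h2
      rw [← mul_sub] at h2
      rcases mul_eq_zero.1 h2 with h3 | h3
      · exact absurd h3 hi
      · rw [show k + (i + 1) = k + 1 + i by ring]; linarith
    · rw [← mul_sub]
      exact mul_nonneg (hq i) (sub_nonneg.2 (hle _))
  set S : Set ℕ := {m | ∃ i, q i ≠ 0 ∧ m = i + 1}
  have hcl : ∀ m ∈ AddSubmonoid.closure S, ∀ k, w k = w 0 → w (k + m) = w 0 := by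
    intro m hm
    induction hm using AddSubmonoid.closure_induction with
    | mem x hx =>
      obtain ⟨i, hi, rfl⟩ := hx
      exact fun k hk => step k hk i hi
    | zero => intro k hk; simpa using hk
    | add x y _ _ hx hy => intro k hk; rw [← add_assoc]; exact hy _ (hx _ hk)
  obtain ⟨N, hN⟩ := Nat.exists_mem_closure_of_ge S
  have hg : Nat.setGcd S = 1 := hap _ fun i hi => Nat.setGcd_dvd_of_mem ⟨i, hi, rfl⟩
  exact ⟨N, fun m hm => by simpa using hcl m (hN m hm (by simp [hg])) 0 rfl⟩

/-- An extremal cluster value `a` of a renewal sequence `u` satisfies `a * ∑ r_i = 1`. Along an ultrafilter with limit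
`a`, the shifted sequences `u (n - k)` have limits `w k`, which satisfy the averaging equation and are extremal
at `k = 0`; hence they are equal to `a` for large `k`. The sign `s = ±1` selects whether `a` is the largest or the
smallest cluster value. -/
theorem extremal_limit_mul_tsum {r u : ℕ → ℝ} (hr0 : r 0 = 1) (hanti : Antitone r)
    (hnn : ∀ i, 0 ≤ r i) (hsum : Summable r) (hu : ∀ n, u n ∈ Set.Icc (0 : ℝ) 1)
    (hid : Tendsto (fun n => ∑ i ∈ Finset.range (n + 1), r i * u (n - i)) atTop (𝓝 1))
    (hap : ∀ d : ℕ, (∀ i, r i ≠ r (i + 1) → d ∣ i + 1) → d = 1)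
    (s : ℝ) (hs : s ≠ 0) {a : ℝ} (ha : MapClusterPt a atTop u)
    (hmax : ∀ b, MapClusterPt b atTop u → s * b ≤ s * a) : a * ∑' i, r i = 1 := by
  obtain ⟨F, hF, hFa⟩ := mapClusterPt_iff_ultrafilter.1 ha
  have hlim : ∀ k : ℕ, ∃ w, Tendsto (fun n => u (n - k)) F (𝓝 w) := by
    intro k
    obtain ⟨w, -, hw⟩ := isCompact_Icc.ultrafilter_le_nhds' (F.map fun n => u (n - k))
      (s := Set.Icc (0 : ℝ) 1) (Ultrafilter.mem_map.2 (Filter.univ_mem' fun n => hu _))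
    exact ⟨w, hw⟩
  choose w hw using hlim
  have hsub : ∀ k : ℕ, Tendsto (fun n : ℕ => n - k) F atTop := fun k =>
    (tendsto_sub_atTop_nat k).mono_left hF
  have hw0 : w 0 = a := tendsto_nhds_unique (by simpa using hw 0) hFa
  have hwa : ∀ k, s * w k ≤ s * a := fun k => hmax _ <| mapClusterPt_iff_ultrafilter.2
    ⟨F.map (fun n => n - k), hsub k, hw k⟩
  have hw01 : ∀ k, w k ∈ Set.Icc (0 : ℝ) 1 := fun k =>
    isClosed_Icc.mem_of_tendsto (hw k) (Eventually.of_forall fun n => hu _)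
  have hsumw : ∀ k, Summable fun i => r i * w (k + i) := fun k =>
    hsum.of_nonneg_of_le (fun i => mul_nonneg (hnn i) (hw01 _).1)
      fun i => mul_le_of_le_one_right (hnn i) (hw01 _).2
  -- The limit of the hypothesis `hid` shifted by `k`.
  have hA : ∀ k, ∑' i, r i * w (k + i) = 1 := by
    intro k
    have h1 : Tendsto (fun n : ℕ => ∑' i, if i ≤ n - k then r i * u (n - k - i) else 0) F
        (𝓝 (∑' i, r i * w (k + i))) := by
      refine tendsto_tsum_of_dominated_convergence hsum (fun i => ?_)
        (Eventually.of_forall fun n i => ?_)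
      · have hev : ∀ᶠ n in (F : Filter ℕ), i ≤ n - k := (hsub k).eventually_ge_atTop i
        refine ((hw (k + i)).const_mul (r i)).congr' ?_
        filter_upwards [hev] with n hn
        rw [if_pos hn, Nat.sub_sub]
      · split_ifs
        · rw [Real.norm_of_nonneg (mul_nonneg (hnn i) (hu _).1)]
          exact mul_le_of_le_one_right (hnn i) (hu _).2
        · simpa using hnn i
    refine tendsto_nhds_unique h1 ((hid.comp (hsub k)).congr fun n => ?_)
    rw [tsum_eq_sum (s := Finset.range (n - k + 1))]
    · exact Finset.sum_congr rfl fun i hi => by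
        rw [if_pos (by simpa [Nat.lt_succ_iff] using hi)]
    · intro i hi
      rw [if_neg (by simpa [Nat.lt_succ_iff] using hi)]
  have hr1 : Summable fun i => r (i + 1) := (summable_nat_add_iff 1).2 hsum
  -- The averaging equation is the difference of two consecutive instances of `hA`.
  have hB : ∀ k, HasSum (fun i => (r i - r (i + 1)) * w (k + 1 + i)) (w k) := by
    intro k
    have h1 := hA k
    rw [(hsumw k).tsum_eq_zero_add] at h1
    have h2 : HasSum (fun i => r (i + 1) * w (k + 1 + i)) (1 - w k) := by
      have h3 := ((summable_nat_add_iff 1).2 (hsumw k)).hasSum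
      rw [hr0, add_zero, one_mul] at h1
      have h4 : ∑' i, r (i + 1) * w (k + (i + 1)) = 1 - w k := by linarith
      rw [h4] at h3
      simpa only [add_assoc, add_comm, add_left_comm] using h3
    have h3 := (hsumw (k + 1)).hasSum
    rw [hA] at h3
    have h4 := h3.sub h2
    rw [sub_sub_cancel] at h4
    exact h4.congr_fun fun i => by ring
  have hq1 : HasSum (fun i => r i - r (i + 1)) 1 := by
    have h := hsum.hasSum.sub hr1.hasSum
    rw [hsum.tsum_eq_zero_add, hr0] at h
    simpa using h
  obtain ⟨N, hN⟩ := eventually_eq_of_averaging (q := fun i => r i - r (i + 1))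
    (w := fun k => s * w k) (fun i => sub_nonneg.2 (hanti i.le_succ)) hq1
    (fun d hd => hap d fun i hi => hd i (sub_ne_zero.2 hi))
    (fun k => ((hB k).mul_left s).congr_fun fun i => by ring) (fun k => by rw [hw0]; exact hwa k)
  have hN' : ∀ m, N ≤ m → w m = a := fun m hm => by
    have := mul_left_cancel₀ hs (hN m hm)
    rw [this, hw0]
  rw [← hA N, ← tsum_mul_left]
  exact tsum_congr fun i => by rw [hN' _ (Nat.le_add_right _ _), mul_comm]

/-- The renewal theorem of Erdős, Feller and Pollard, for a possibly delayed renewal sequence `u` and the tail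
function `r i = P(Y > i)` of an aperiodic step distribution with finite mean `∑ r i`. -/
theorem renewal_limit {r u : ℕ → ℝ} (hr0 : r 0 = 1) (hanti : Antitone r)
    (hnn : ∀ i, 0 ≤ r i) (hsum : Summable r) (hu : ∀ n, u n ∈ Set.Icc (0 : ℝ) 1)
    (hid : Tendsto (fun n => ∑ i ∈ Finset.range (n + 1), r i * u (n - i)) atTop (𝓝 1))
    (hap : ∀ d : ℕ, (∀ i, r i ≠ r (i + 1) → d ∣ i + 1) → d = 1) :
    Tendsto u atTop (𝓝 (∑' i, r i)⁻¹) := by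
  set K : Set ℝ := {b | MapClusterPt b atTop u}
  have hKI : K ⊆ Set.Icc 0 1 := fun b hb => by
    obtain ⟨F, -, hF⟩ := mapClusterPt_iff_ultrafilter.1 hb
    exact isClosed_Icc.mem_of_tendsto hF (Eventually.of_forall fun n => hu _)
  have hKc : IsCompact K := isCompact_Icc.of_isClosed_subset isClosed_setOfPred_clusterPt hKI
  have hKne : K.Nonempty := by
    obtain ⟨b, -, hb⟩ := isCompact_Icc.exists_mapClusterPt (s := Set.Icc (0 : ℝ) 1) (u := u)
      (f := atTop) (tendsto_principal.2 (Eventually.of_forall hu))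
    exact ⟨b, hb⟩
  obtain ⟨M, hM, hMmax⟩ := hKc.exists_isGreatest hKne
  obtain ⟨m, hm, hmmin⟩ := hKc.exists_isLeast hKne
  have h1 := extremal_limit_mul_tsum hr0 hanti hnn hsum hu hid hap 1 one_ne_zero hM
    fun b hb => by simpa using hMmax hb
  have h2 := extremal_limit_mul_tsum hr0 hanti hnn hsum hu hid hap (-1) (by norm_num) hm
    fun b hb => by simpa using hmmin hb
  refine isCompact_Icc.tendsto_nhds_of_unique_mapClusterPt (Eventually.of_forall hu) fun b _ hb => ?_
  have hM' := eq_inv_of_mul_eq_one_left h1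
  have hm' := eq_inv_of_mul_eq_one_left h2
  exact le_antisymm ((hMmax hb).trans_eq hM') (hm'.symm.trans_le (hmmin hb))

/-- Convolution of a convergent bounded sequence with a summable or divergent nonnegative sequence: dominated
convergence in the first case, Fatou's lemma in the second. -/
theorem tendsto_convolution {u g : ℕ → ℝ≥0∞} {c : ℝ≥0∞} (hu : Tendsto u atTop (𝓝 c))
    (hu1 : ∀ n, u n ≤ 1) (hc : c ≠ 0) :
    Tendsto (fun n => ∑ i ∈ Finset.range n, u (n - 1 - i) * g i) atTop
      (𝓝 (c * ∑' i, g i)) := by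
  set F : ℕ → ℕ → ℝ≥0∞ := fun n i => if i < n then u (n - 1 - i) * g i else 0
  have hF : ∀ n, ∑ i ∈ Finset.range n, u (n - 1 - i) * g i = ∫⁻ i, F n i ∂Measure.count := by
    intro n
    rw [lintegral_count, tsum_eq_sum (s := Finset.range n)]
    · exact Finset.sum_congr rfl fun i hi => by simp only [F]; rw [if_pos (Finset.mem_range.1 hi)]
    · intro i hi
      simp only [F]; rw [if_neg (by simpa using hi)]
  have hlim : ∀ i, Tendsto (fun n => F n i) atTop (𝓝 (c * g i)) := by
    intro i
    have h1 : Tendsto (fun n => u (n - 1 - i)) atTop (𝓝 c) :=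
      hu.comp ((tendsto_sub_atTop_nat i).comp (tendsto_sub_atTop_nat 1))
    refine (ENNReal.Tendsto.mul_const h1 (Or.inl hc)).congr' ?_
    filter_upwards [eventually_gt_atTop i] with n hn
    simp only [F]; rw [if_pos hn]
  simp_rw [hF]
  rw [← ENNReal.tsum_mul_left, ← lintegral_count]
  by_cases hg : ∑' i, g i = ⊤
  · have htop : ∫⁻ i, c * g i ∂Measure.count = ⊤ := by
      rw [lintegral_count, ENNReal.tsum_mul_left, hg, ENNReal.mul_top hc]
    refine tendsto_of_le_liminf_of_limsup_le ?_ (by rw [htop]; exact le_top)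
    refine le_trans (le_of_eq ?_) (lintegral_liminf_le fun n => measurable_from_top)
    exact lintegral_congr fun i => (hlim i).liminf_eq.symm
  · refine tendsto_lintegral_of_dominated_convergence g (fun n => measurable_from_top)
      (fun n => Eventually.of_forall fun i => ?_) (by rwa [lintegral_count])
      (Eventually.of_forall hlim)
    simp only [F]
    split_ifs
    · exact mul_le_of_le_one_left' (hu1 _)
    · exact zero_le

/-! ### Cycles inside an interval -/

/-- The cycles of `f` inside `{a + 1, …, b}` whose length satisfies `q`. The choices `q = (· = j)` and
`q = True` give the sets counted by `cycleCount` and `totalCycleCount`. -/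
def cyclesIn (f : Equiv.Perm ℕ+) (q : ℕ → Prop) (a b : ℕ) : Set (Set ℕ+) :=
  {C | IsCycleSet f C ∧ q C.ncard ∧ ∀ y ∈ C, a < (y : ℕ) ∧ (y : ℕ) ≤ b}

theorem cycleCount_eq (f : Equiv.Perm ℕ+) (a b j : ℕ) :
    cycleCount f a b j = (cyclesIn f (· = j) a b).ncard := rfl

theorem totalCycleCount_eq (f : Equiv.Perm ℕ+) (a b : ℕ) :
    totalCycleCount f a b = (cyclesIn f (fun _ => True) a b).ncard := by
  simp [totalCycleCount, cyclesIn]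

theorem finite_cyclesIn (f : Equiv.Perm ℕ+) (q : ℕ → Prop) (a b : ℕ) :
    (cyclesIn f q a b).Finite := by
  have hfin : {y : ℕ+ | (y : ℕ) ≤ b}.Finite :=
    Set.Finite.preimage PNat.coe_injective.injOn (Set.finite_Iic b)
  exact hfin.finite_subsets.subset fun C hC y hy => (hC.2.2 y hy).2

theorem cyclesIn_mono (f : Equiv.Perm ℕ+) (q : ℕ → Prop) {a a' b b' : ℕ} (ha : a' ≤ a)
    (hb : b ≤ b') : cyclesIn f q a b ⊆ cyclesIn f q a' b' := fun _ hC =>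
  ⟨hC.1, hC.2.1, fun y hy => ⟨ha.trans_lt (hC.2.2 y hy).1, (hC.2.2 y hy).2.trans hb⟩⟩

theorem SplitsAt.le_iff_of_sameCycle {f : Equiv.Perm ℕ+} {n : ℕ} (h : SplitsAt f n) {x y : ℕ+}
    (hxy : f.SameCycle x y) : (y : ℕ) ≤ n ↔ (x : ℕ) ≤ n := by
  have hpow : ∀ (k : ℕ) (x : ℕ+), (((f ^ k) x : ℕ+) : ℕ) ≤ n ↔ (x : ℕ) ≤ n := by
    intro k
    induction k with
    | zero => simp
    | succ k ih => intro x; rw [pow_succ', Equiv.Perm.mul_apply, h, ih]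
  obtain ⟨i, rfl⟩ := hxy
  obtain ⟨k, rfl | rfl⟩ := i.eq_nat_or_neg
  · simpa using hpow k x
  · have := hpow k ((f ^ (-(k : ℤ))) x)
    rw [← this, zpow_neg, zpow_natCast, Equiv.Perm.inv_def, Equiv.apply_symm_apply]

/-- Cycles do not cross a splitting time. -/
theorem ncard_cyclesIn_add {f : Equiv.Perm ℕ+} (q : ℕ → Prop) {a b c : ℕ} (hab : a ≤ b)
    (hbc : b ≤ c) (h : SplitsAt f b) :
    (cyclesIn f q a c).ncard = (cyclesIn f q a b).ncard + (cyclesIn f q b c).ncard := by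
  rw [← Set.ncard_union_eq _ (finite_cyclesIn f q a b) (finite_cyclesIn f q b c)]
  · congr 1
    refine Set.Subset.antisymm (fun C hC => ?_) (Set.union_subset
      (cyclesIn_mono f q le_rfl hbc) (cyclesIn_mono f q hab le_rfl))
    obtain ⟨x, rfl⟩ := hC.1
    by_cases hx : (x : ℕ) ≤ b
    · exact Or.inl ⟨hC.1, hC.2.1, fun y hy =>
        ⟨(hC.2.2 y hy).1, (h.le_iff_of_sameCycle hy).2 hx⟩⟩
    · exact Or.inr ⟨hC.1, hC.2.1, fun y hy =>
        ⟨not_le.1 fun hy' => hx ((h.le_iff_of_sameCycle hy).1 hy'), (hC.2.2 y hy).2⟩⟩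
  · rw [Set.disjoint_left]
    intro C hC hC'
    obtain ⟨x, rfl⟩ := hC.1
    have h1 := hC.2.2 x (Equiv.Perm.SameCycle.refl f x)
    have h2 := hC'.2.2 x (Equiv.Perm.SameCycle.refl f x)
    omega

open Classical in
/-- The number of cycles of a finite permutation whose length satisfies `q`, computed by giving each point of
such a cycle the reciprocal of the length as its weight. -/
noncomputable def cycleWeight (q : ℕ → Prop) {n : ℕ} (σ : Equiv.Perm (Fin n)) : ℝ :=
  ∑ x, if q (Function.minimalPeriod σ x) then ((Function.minimalPeriod σ x : ℕ) : ℝ)⁻¹ else 0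

theorem minimalPeriod_perm_pos {n : ℕ} (σ : Equiv.Perm (Fin n)) (x : Fin n) :
    0 < Function.minimalPeriod σ x :=
  Function.minimalPeriod_pos_of_mem_periodicPts (σ.injective.mem_periodicPts x)

theorem ncard_sameCycle {n : ℕ} (σ : Equiv.Perm (Fin n)) (x : Fin n) :
    {y | σ.SameCycle x y}.ncard = Function.minimalPeriod σ x := by
  have h : {y | σ.SameCycle x y} =
      (fun k => σ^[k] x) '' (Set.Iio (Function.minimalPeriod σ x)) := by
    ext y
    simp only [Set.mem_ofPred_eq, Set.mem_image, Set.mem_Iio]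
    constructor
    · intro hxy
      obtain ⟨k, rfl⟩ := hxy.exists_nat_pow_eq
      exact ⟨k % Function.minimalPeriod σ x, Nat.mod_lt _ (minimalPeriod_perm_pos σ x), by
        rw [Function.iterate_mod_minimalPeriod_eq, ← Equiv.Perm.coe_pow]⟩
    · rintro ⟨k, -, rfl⟩
      exact ⟨k, by rw [zpow_natCast, Equiv.Perm.coe_pow]⟩
  rw [h, Function.iterate_injOn_Iio_minimalPeriod.ncard_image]
  simp [Set.ncard_eq_toFinset_card']

/-- A permutation which splits at both ends of an interval restricts to a permutation of the interval. -/
theorem exists_reducedBlockIs {f : Equiv.Perm ℕ+} {a n : ℕ} (ha : SplitsAt f a)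
    (hb : SplitsAt f (a + n)) : ∃ σ, ReducedBlockIs f a n σ := by
  have key : ∀ j : Fin n, a < (f (Nat.succPNat (a + j)) : ℕ) ∧
      (f (Nat.succPNat (a + j)) : ℕ) ≤ a + n := by
    intro j
    have h1 := ha (Nat.succPNat (a + j))
    have h2 := hb (Nat.succPNat (a + j))
    have h3 : (Nat.succPNat (a + j) : ℕ) = a + j + 1 := rfl
    have := j.2
    omega
  let g : Fin n → Fin n := fun j => ⟨(f (Nat.succPNat (a + j)) : ℕ) - a - 1, by
    have := key j; omega⟩
  have hg : ∀ j : Fin n, f (Nat.succPNat (a + j)) = Nat.succPNat (a + g j) := fun j => by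
    apply PNat.eq
    have h1 := key j
    have h3 : (Nat.succPNat (a + g j) : ℕ) = a + (g j : ℕ) + 1 := rfl
    have h4 : (g j : ℕ) = (f (Nat.succPNat (a + j)) : ℕ) - a - 1 := rfl
    omega
  have hinj : Function.Injective g := by
    intro i j hij
    have h1 : f (Nat.succPNat (a + i)) = f (Nat.succPNat (a + j)) := by rw [hg, hg, hij]
    have h2 := Nat.succPNat_injective (f.injective h1)
    exact Fin.ext (by omega)
  exact ⟨Equiv.ofBijective g (Finite.injective_iff_bijective.1 hinj), hg⟩

theorem ReducedBlockIs.unique {f : Equiv.Perm ℕ+} {a n : ℕ} {σ τ : Equiv.Perm (Fin n)}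
    (hσ : ReducedBlockIs f a n σ) (hτ : ReducedBlockIs f a n τ) : σ = τ := by
  ext j
  have h := Nat.succPNat_injective ((hσ j).symm.trans (hτ j))
  omega

theorem ncard_cyclesIn_block {f : Equiv.Perm ℕ+} (q : ℕ → Prop) {a n : ℕ}
    {σ : Equiv.Perm (Fin n)} (h : ReducedBlockIs f a n σ) :
    ((cyclesIn f q a (a + n)).ncard : ℝ) = cycleWeight q σ := by
  classical
  set e : Fin n → ℕ+ := fun j => Nat.succPNat (a + j)
  have he : Function.Injective e := fun i j hij => by
    have := Nat.succPNat_injective hij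
    exact Fin.ext (by omega)
  have hfe : ∀ j, f (e j) = e (σ j) := h
  have hpow : ∀ (k : ℕ) (j : Fin n), (f ^ k) (e j) = e ((σ ^ k) j) := by
    intro k
    induction k with
    | zero => simp
    | succ k ih => intro j; rw [pow_succ', Equiv.Perm.mul_apply, ih, hfe, pow_succ',
        Equiv.Perm.mul_apply]
  have hcyc : ∀ x, {y | f.SameCycle (e x) y} = e '' {y | σ.SameCycle x y} := by
    intro x
    ext y
    simp only [Set.mem_ofPred_eq, Set.mem_image]
    constructor
    · rintro ⟨i, rfl⟩
      obtain ⟨k, rfl | rfl⟩ := i.eq_nat_or_neg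
      · exact ⟨(σ ^ k) x, ⟨k, by simp⟩, by rw [zpow_natCast, hpow]⟩
      · refine ⟨(σ ^ (-(k : ℤ))) x, ⟨_, rfl⟩, (f ^ k).injective ?_⟩
        rw [hpow, zpow_neg, zpow_neg, zpow_natCast, zpow_natCast, Equiv.Perm.inv_def, Equiv.apply_symm_apply,
          Equiv.Perm.inv_def, Equiv.apply_symm_apply]
    · rintro ⟨y, hy, rfl⟩
      obtain ⟨k, rfl⟩ := hy.exists_nat_pow_eq
      exact ⟨k, by rw [zpow_natCast, hpow]⟩
  have hcard : ∀ x, {y | f.SameCycle (e x) y}.ncard = Function.minimalPeriod σ x := fun x => by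
    rw [hcyc, Set.ncard_image_of_injective _ he, ncard_sameCycle]
  -- `c x` is the cycle through `e x`; it has as many elements as there are `x'` with `c x' = c x`, so that the
  -- weights on each cycle add up to one.
  set c : Fin n → Set ℕ+ := fun x => {y | f.SameCycle (e x) y}
  have himg : cyclesIn f q a (a + n) =
      ((Finset.univ.filter fun x => q (Function.minimalPeriod σ x)).image c : Finset (Set ℕ+)) := by
    ext C
    simp only [Finset.coe_image, Finset.coe_filter, Finset.mem_univ, true_and, Set.mem_image,
      Set.mem_ofPred_eq]
    constructor
    · rintro ⟨⟨x, rfl⟩, hq, hC⟩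
      have hx := hC x (Equiv.Perm.SameCycle.refl f x)
      obtain ⟨j, rfl⟩ : ∃ j, e j = x := ⟨⟨(x : ℕ) - a - 1, by omega⟩, PNat.eq (by
        change a + ((x : ℕ) - a - 1) + 1 = (x : ℕ)
        omega)⟩
      exact ⟨j, by rwa [hcard] at hq, rfl⟩
    · rintro ⟨x, hx, rfl⟩
      refine ⟨⟨_, rfl⟩, by rwa [hcard], fun y hy => ?_⟩
      simp only [c] at hy
      rw [hcyc] at hy
      obtain ⟨j, -, rfl⟩ := hy
      have := j.2
      change a < a + j + 1 ∧ a + j + 1 ≤ a + n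
      omega
  rw [himg, Set.ncard_coe_finset, cycleWeight, ← Finset.sum_filter]
  have hsum := Finset.sum_fiberwise_of_maps_to (g := c)
    (s := Finset.univ.filter fun x => q (Function.minimalPeriod σ x))
    (fun x hx => Finset.mem_image_of_mem c hx)
    (fun x => ((Function.minimalPeriod σ x : ℕ) : ℝ)⁻¹)
  rw [← hsum, Finset.card_eq_sum_ones, Nat.cast_sum]
  refine Finset.sum_congr rfl fun C hC => ?_
  obtain ⟨x, hx, rfl⟩ := Finset.mem_image.1 hC
  have hxq : q (Function.minimalPeriod σ x) := (Finset.mem_filter.1 hx).2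
  have hceq : ∀ y, c y = c x → Function.minimalPeriod σ y = Function.minimalPeriod σ x := by
    intro y hy
    rw [← hcard, ← hcard]; exact congrArg Set.ncard hy
  rw [Finset.sum_congr rfl (g := fun _ => ((Function.minimalPeriod σ x : ℕ) : ℝ)⁻¹)
    fun y hy => by rw [hceq y (Finset.mem_filter.1 hy).2]]
  rw [Finset.sum_const, nsmul_eq_mul]
  have hfib : (Finset.filter (fun y => c y = c x)
      (Finset.univ.filter fun y => q (Function.minimalPeriod σ y))).card =
      Function.minimalPeriod σ x := by
    rw [← ncard_sameCycle, ← Set.ncard_coe_finset]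
    congr 1
    ext y
    simp only [Finset.coe_filter, Finset.mem_filter, Finset.mem_univ, true_and, Set.mem_ofPred_eq]
    constructor
    · rintro ⟨-, hy⟩
      have : e y ∈ c x := hy ▸ Equiv.Perm.SameCycle.refl f (e y)
      simp only [c] at this
      rw [hcyc] at this
      obtain ⟨z, hz, hzy⟩ := this
      exact he hzy ▸ hz
    · intro hy
      have h1 : f.SameCycle (e x) (e y) := by
        have : e y ∈ e '' {y | σ.SameCycle x y} := ⟨y, hy, rfl⟩
        rw [← hcyc] at this
        exact this
      have h2 : c y = c x := by
        ext z
        exact ⟨fun hz => h1.trans hz, fun hz => h1.symm.trans hz⟩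
      exact ⟨by rwa [hceq y h2], h2⟩
  rw [hfib, Nat.cast_one, mul_inv_cancel₀]
  exact_mod_cast (minimalPeriod_perm_pos σ x).ne'

/-! ### Cycles of a uniform random permutation -/

/-- The permutations carrying one embedding of `Fin j` to another form the same proportion of all permutations for
all pairs of embeddings, because the symmetric group acts transitively on embeddings. -/
theorem card_perm_extending {α : Type*} [Fintype α] [DecidableEq α] {j : ℕ} (e e' : Fin j ↪ α) :
    (Finset.univ.filter fun σ : Equiv.Perm α => ∀ i, σ (e i) = e' i).card *
      Fintype.card (Fin j ↪ α) = (Fintype.card α).factorial := by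
  classical
  have hpre : MulAction.IsPretransitive (Equiv.Perm α) (Fin j ↪ α) :=
    Equiv.Perm.isMultiplyPretransitive α j
  have hsm : ∀ (τ : Equiv.Perm α) (e : Fin j ↪ α) (i), (τ • e) i = τ (e i) := fun τ e i => rfl
  have hconst : ∀ e'' : Fin j ↪ α,
      (Finset.univ.filter fun σ : Equiv.Perm α => ∀ i, σ (e i) = e'' i).card =
      (Finset.univ.filter fun σ : Equiv.Perm α => ∀ i, σ (e i) = e' i).card := by
    intro e''
    obtain ⟨τ, hτ⟩ := hpre.exists_smul_eq e'' e'
    refine Finset.card_bij (fun σ _ => τ * σ) (fun σ hσ => ?_) (fun _ _ _ _ h => mul_left_cancel h)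
      fun σ hσ => ⟨τ⁻¹ * σ, ?_, mul_inv_cancel_left _ _⟩
    · simp only [Finset.mem_filter, Finset.mem_univ, true_and] at hσ ⊢
      intro i
      rw [Equiv.Perm.mul_apply, hσ, ← hsm, hτ]
    · simp only [Finset.mem_filter, Finset.mem_univ, true_and] at hσ ⊢
      intro i
      rw [Equiv.Perm.mul_apply, hσ, ← hτ, hsm, Equiv.Perm.inv_def, Equiv.symm_apply_apply]
  have hfib := Finset.card_eq_sum_card_fiberwise (f := fun σ : Equiv.Perm α => σ • e)
    (s := Finset.univ) (t := Finset.univ) (fun _ _ => Finset.mem_univ _)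
  rw [← Fintype.card_perm, ← Finset.card_univ (α := Equiv.Perm α), hfib]
  rw [Finset.sum_congr rfl (g := fun _ => (Finset.univ.filter fun σ : Equiv.Perm α =>
    ∀ i, σ (e i) = e' i).card)]
  · rw [Finset.sum_const, Finset.card_univ, smul_eq_mul, mul_comm]
  · intro e'' _
    rw [← hconst e'']
    congr 1
    ext σ
    simp only [Finset.mem_filter, Finset.mem_univ, true_and]
    exact DFunLike.ext_iff

/-- Points of period `j` of `σ` correspond to embeddings `e` of the cyclically ordered set `Fin j` which intertwine
the rotation with `σ`. -/
theorem card_minimalPeriod_eq {n j : ℕ} (σ : Equiv.Perm (Fin n)) (hj : 0 < j) :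
    (Finset.univ.filter fun x => Function.minimalPeriod σ x = j).card =
      (Finset.univ.filter fun e : Fin j ↪ Fin n => ∀ i, σ (e i) = e (finRotate j i)).card := by
  obtain ⟨m, rfl⟩ : ∃ m, j = m + 1 := ⟨j - 1, by omega⟩
  symm
  have hiter : ∀ e : Fin (m + 1) ↪ Fin n, (∀ i, σ (e i) = e (finRotate (m + 1) i)) →
      ∀ k (hk : k < m + 1), σ^[k] (e 0) = e ⟨k, hk⟩ := by
    intro e he k
    induction k with
    | zero => intro _; rfl
    | succ k ih =>
      intro hk
      rw [Function.iterate_succ_apply', ih (by omega), he, finRotate_of_lt (by omega)]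
  -- The embedding with `e 0 = x` is `i ↦ σ^[i] x`.
  refine Finset.card_bij (fun e _ => e 0) (fun e he => ?_) (fun e he e' he' h => ?_) fun x hx => ?_
  · simp only [Finset.mem_filter, Finset.mem_univ, true_and] at he ⊢
    have hper : Function.IsPeriodicPt σ (m + 1) (e 0) := by
      unfold Function.IsPeriodicPt Function.IsFixedPt
      rw [Function.iterate_succ_apply', hiter e he m (by omega), he]
      congr 1
      exact finRotate_last
    refine le_antisymm (hper.minimalPeriod_le (by omega)) ?_
    by_contra! hlt
    have h1 := hiter e he _ hlt
    rw [Function.iterate_minimalPeriod] at h1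
    have h2 := e.injective h1
    have h3 := minimalPeriod_perm_pos σ (e 0)
    have h4 := congrArg Fin.val h2
    simp at h4
    omega
  · simp only [Finset.mem_filter, Finset.mem_univ, true_and] at he he'
    ext i
    rw [← hiter e he i i.2, ← hiter e' he' i i.2]
    exact congrArg (fun y => (σ^[(i : ℕ)] y : Fin n).val) h
  · simp only [Finset.mem_filter, Finset.mem_univ, true_and] at hx
    refine ⟨⟨fun i => σ^[i] x, fun i k hik => Fin.ext ?_⟩, ?_, rfl⟩
    · exact Function.iterate_injOn_Iio_minimalPeriod (f := σ) (x := x)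
        (by rw [hx]; exact i.2) (by rw [hx]; exact k.2) hik
    · simp only [Finset.mem_filter, Finset.mem_univ, true_and]
      intro i
      change σ (σ^[(i : ℕ)] x) = σ^[((finRotate (m + 1) i : Fin (m + 1)) : ℕ)] x
      rw [← Function.iterate_succ_apply' σ]
      rcases Nat.lt_or_ge (i : ℕ) m with hi | hi
      · rw [finRotate_of_lt hi]
      · have hi' : i = Fin.last m := Fin.ext (by simp; omega)
        subst hi'
        have := Function.iterate_minimalPeriod (f := σ) (x := x)
        rw [hx] at this
        rw [finRotate_last]
        simpa using this

/-- On average, a uniform permutation of `n ≥ j` points has one point in cycles of length `j`. -/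
theorem sum_card_minimalPeriod {n j : ℕ} (hj : 0 < j) (hjn : j ≤ n) :
    ∑ σ : Equiv.Perm (Fin n), (Finset.univ.filter fun x => Function.minimalPeriod σ x = j).card =
      n.factorial := by
  have hne : Nonempty (Fin j ↪ Fin n) := ⟨Fin.castLEEmb hjn⟩
  have h1 : ∑ σ : Equiv.Perm (Fin n),
      (Finset.univ.filter fun x => Function.minimalPeriod σ x = j).card =
      ∑ e : Fin j ↪ Fin n, (Finset.univ.filter fun σ : Equiv.Perm (Fin n) =>
        ∀ i, σ (e i) = e (finRotate j i)).card := by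
    simp_rw [card_minimalPeriod_eq _ hj, Finset.card_filter]
    exact Finset.sum_comm
  have h2 : ∀ e : Fin j ↪ Fin n, (Finset.univ.filter fun σ : Equiv.Perm (Fin n) =>
        ∀ i, σ (e i) = e (finRotate j i)).card * Fintype.card (Fin j ↪ Fin n) = n.factorial := by
    intro e
    have := card_perm_extending e ((finRotate j).toEmbedding.trans e)
    rwa [Fintype.card_fin] at this
  refine Nat.eq_of_mul_eq_mul_right (Fintype.card_pos (α := Fin j ↪ Fin n)) ?_
  rw [h1, Finset.sum_mul, Finset.sum_congr rfl fun e _ => h2 e, Finset.sum_const,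
    Finset.card_univ, smul_eq_mul, mul_comm]

open Classical in
theorem sum_cycleWeight (q : ℕ → Prop) (n : ℕ) :
    ∑ σ : Equiv.Perm (Fin n), cycleWeight q σ =
      n.factorial * ∑ j ∈ Finset.Icc 1 n, if q j then (j : ℝ)⁻¹ else 0 := by
  have h1 : ∀ σ : Equiv.Perm (Fin n), cycleWeight q σ = ∑ j ∈ Finset.Icc 1 n,
      ((Finset.univ.filter fun x => Function.minimalPeriod σ x = j).card : ℝ) *
        (if q j then (j : ℝ)⁻¹ else 0) := by
    intro σ
    rw [cycleWeight, ← Finset.sum_fiberwise_of_maps_to (g := fun x => Function.minimalPeriod σ x)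
      (t := Finset.Icc 1 n)]
    · refine Finset.sum_congr rfl fun j _ => ?_
      rw [← nsmul_eq_mul, ← Finset.sum_const]
      exact Finset.sum_congr rfl fun x hx => by rw [(Finset.mem_filter.1 hx).2]
    · intro x _
      refine Finset.mem_Icc.2 ⟨minimalPeriod_perm_pos σ x, ?_⟩
      simpa using Function.minimalPeriod_le_card (f := σ) (x := x)
  simp_rw [h1]
  rw [Finset.sum_comm, Finset.mul_sum]
  refine Finset.sum_congr rfl fun j hj => ?_
  rw [← Finset.sum_mul, ← Nat.cast_sum, sum_card_minimalPeriod (Finset.mem_Icc.1 hj).1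
    (Finset.mem_Icc.1 hj).2]

theorem cycleWeight_nonneg (q : ℕ → Prop) {n : ℕ} (σ : Equiv.Perm (Fin n)) :
    0 ≤ cycleWeight q σ :=
  Finset.sum_nonneg fun x _ => by split_ifs <;> positivity

/-! ### Displacements of a uniform random permutation and the function `δ_r` -/

/-- A sum over pairs in a square of a function of the difference, ordered by differences. -/
theorem sum_sum_sub {R : Type*} [CommSemiring R] (φ : ℤ → R) (n : ℕ) :
    ∑ a ∈ Finset.range n, ∑ b ∈ Finset.range n, φ ((b : ℤ) - a) =
      n * φ 0 + ∑ d ∈ Finset.range n,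
        ((n - 1 - d : ℕ) : R) * (φ ((d : ℤ) + 1) + φ (-((d : ℤ) + 1))) := by
  induction n with
  | zero => simp
  | succ n ih =>
    simp_rw [Finset.sum_range_succ _ n]
    rw [Finset.sum_add_distrib, ih]
    have h1 : ∑ x ∈ Finset.range n, φ ((n : ℤ) - x) =
        ∑ d ∈ Finset.range n, φ ((d : ℤ) + 1) := by
      rw [← Finset.sum_range_reflect]
      refine Finset.sum_congr rfl fun d hd => ?_
      have := Finset.mem_range.1 hd
      congr 1; omega
    have h2 : ∑ x ∈ Finset.range n, φ ((x : ℤ) - n) =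
        ∑ d ∈ Finset.range n, φ (-((d : ℤ) + 1)) := by
      rw [← Finset.sum_range_reflect]
      refine Finset.sum_congr rfl fun d hd => ?_
      have := Finset.mem_range.1 hd
      congr 1; omega
    have h3 : ∑ d ∈ Finset.range n,
        ((n + 1 - 1 - d : ℕ) : R) * (φ ((d : ℤ) + 1) + φ (-((d : ℤ) + 1))) =
        ∑ d ∈ Finset.range n,
          ((n - 1 - d : ℕ) : R) * (φ ((d : ℤ) + 1) + φ (-((d : ℤ) + 1))) +
        ∑ d ∈ Finset.range n, (φ ((d : ℤ) + 1) + φ (-((d : ℤ) + 1))) := by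
      rw [← Finset.sum_add_distrib]
      refine Finset.sum_congr rfl fun d hd => ?_
      have := Finset.mem_range.1 hd
      rw [show n + 1 - 1 - d = n - 1 - d + 1 by omega]
      push_cast; ring
    rw [h1, h2, h3, Finset.sum_add_distrib]
    simp only [add_tsub_cancel_right, tsub_self, Nat.cast_zero, zero_mul, add_zero, sub_self]
    push_cast
    ring

/-- The sum over `a ∈ {1, …, n}` of the mean of `φ` at the displacement of `a` under a uniform permutation of
`{1, …, n}`; the image of each `a` is uniform. -/
noncomputable def blockMean (φ : ℤ → ℝ≥0∞) (n : ℕ) : ℝ≥0∞ :=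
  (∑ a ∈ Finset.range n, ∑ b ∈ Finset.range n, φ ((b : ℤ) - a)) / n

theorem blockMean_ofReal {f : ℤ → ℝ} (hf : ∀ d, 0 ≤ f d) (n : ℕ+) :
    blockMean (fun d => ENNReal.ofReal (f d)) n = ENNReal.ofReal ((n * f 0 + ∑ d ∈ Finset.range n,
      (n - 1 - d : ℝ) * (f ((d : ℤ) + 1) + f (-((d : ℤ) + 1)))) / n) := by
  rw [blockMean, ENNReal.ofReal_div_of_pos (by exact_mod_cast n.pos), ENNReal.ofReal_natCast]
  congr 1
  have h := sum_sum_sub f n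
  have h2 : ∑ d ∈ Finset.range (n : ℕ),
      ((n - 1 - d : ℕ) : ℝ) * (f ((d : ℤ) + 1) + f (-((d : ℤ) + 1))) =
      ∑ d ∈ Finset.range n, (n - 1 - d : ℝ) * (f ((d : ℤ) + 1) + f (-((d : ℤ) + 1))) := by
    refine Finset.sum_congr rfl fun d hd => ?_
    have := Finset.mem_range.1 hd
    rw [Nat.sub_sub, Nat.cast_sub (by omega)]
    push_cast; ring
  rw [← h2, ← h, ENNReal.ofReal_sum_of_nonneg fun a _ => Finset.sum_nonneg fun b _ => hf _]
  exact Finset.sum_congr rfl fun a _ => (ENNReal.ofReal_sum_of_nonneg fun b _ => hf _).symm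

theorem blockMean_one (n : ℕ+) : blockMean (fun _ => 1) n = n := by
  have hn : ((n : ℕ) : ℝ≥0∞) ≠ 0 := by exact_mod_cast n.ne_zero
  simp [blockMean, ENNReal.mul_div_cancel_right hn]

theorem blockMean_single (d : ℤ) (n : ℕ+) :
    blockMean (fun x => if x = d then 1 else 0) n =
      ENNReal.ofReal (max ((n : ℝ) - |(d : ℝ)|) 0 / n) := by
  have h := blockMean_ofReal (f := fun x => if x = d then 1 else 0)
    (fun x => by split_ifs <;> norm_num) n
  have h0 : (fun x : ℤ => ENNReal.ofReal (if x = d then 1 else 0)) =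
      fun x => if x = d then 1 else 0 := by
    funext x; split_ifs <;> simp
  rw [h0] at h
  rw [h]
  congr 2
  have key : ∀ m : ℕ, ∑ x ∈ Finset.range n, ((n : ℝ) - 1 - x) * (if x = m then 1 else 0) =
      max ((n : ℝ) - (m + 1)) 0 := by
    intro m
    simp only [mul_ite, mul_one, mul_zero, Finset.sum_ite_eq', Finset.mem_range]
    split_ifs with hm
    · have : (m : ℝ) + 1 ≤ n := by exact_mod_cast hm
      rw [max_eq_left (by linarith)]; ring
    · have : (n : ℝ) ≤ m + 1 := by exact_mod_cast (not_lt.1 hm).trans (Nat.le_succ m)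
      rw [max_eq_right (by linarith)]
  rcases lt_trichotomy d 0 with hd | rfl | hd
  · obtain ⟨m, rfl⟩ : ∃ m : ℕ, d = -((m : ℤ) + 1) := ⟨(-d - 1).toNat, by omega⟩
    have hsum : ∀ x : ℕ, ((if (x : ℤ) + 1 = -((m : ℤ) + 1) then 1 else 0) +
        (if -((x : ℤ) + 1) = -((m : ℤ) + 1) then 1 else 0) : ℝ) = if x = m then 1 else 0 := by
      intro x
      rw [if_neg (by omega), zero_add]
      exact if_congr (by omega) rfl rfl
    simp_rw [hsum, key]
    rw [if_neg (by omega)]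
    push_cast
    rw [abs_neg, abs_of_nonneg (by positivity)]
    ring
  · have hsum : ∀ x : ℕ, ((if (x : ℤ) + 1 = 0 then 1 else 0) +
        (if -((x : ℤ) + 1) = 0 then 1 else 0) : ℝ) = 0 := by
      intro x
      rw [if_neg (by omega), if_neg (by omega), zero_add]
    simp_rw [hsum]
    simp
  · obtain ⟨m, rfl⟩ : ∃ m : ℕ, d = (m : ℤ) + 1 := ⟨(d - 1).toNat, by omega⟩
    have hsum : ∀ x : ℕ, ((if (x : ℤ) + 1 = (m : ℤ) + 1 then 1 else 0) +
        (if -((x : ℤ) + 1) = (m : ℤ) + 1 then 1 else 0) : ℝ) = if x = m then 1 else 0 := by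
      intro x
      rw [if_neg (c := -((x : ℤ) + 1) = (m : ℤ) + 1) (by omega), add_zero]
      exact if_congr (by omega) rfl rfl
    simp_rw [hsum, key]
    rw [if_neg (by omega)]
    push_cast
    rw [abs_of_nonneg (by positivity)]
    ring

theorem sum_range_sub_one_sub (n : ℕ) :
    ∑ d ∈ Finset.range n, ((n : ℝ) - 1 - d) = n * (n - 1) / 2 := by
  rw [← Finset.sum_range_reflect, Finset.sum_congr rfl (g := fun d : ℕ => (d : ℝ))]
  · induction n with
    | zero => simp
    | succ n ih => rw [Finset.sum_range_succ, ih]; push_cast; ring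
  · intro d hd
    have := Finset.mem_range.1 hd
    rw [Nat.sub_sub, Nat.cast_sub (by omega)]
    push_cast; ring

theorem blockMean_pos (n : ℕ+) :
    blockMean (fun x => if 0 < x then 1 else 0) n = ENNReal.ofReal (((n : ℝ) - 1) / 2) := by
  have h := blockMean_ofReal (f := fun x => if 0 < x then 1 else 0)
    (fun x => by split_ifs <;> norm_num) n
  have h0 : (fun x : ℤ => ENNReal.ofReal (if 0 < x then 1 else 0)) =
      fun x => if 0 < x then 1 else 0 := by
    funext x; split_ifs <;> simp
  rw [h0] at h
  rw [h]
  have hsum : ∀ x : ℕ, ((if 0 < (x : ℤ) + 1 then 1 else 0) +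
      (if 0 < -((x : ℤ) + 1) then 1 else 0) : ℝ) = 1 := by
    intro x
    rw [if_pos (by omega), if_neg (by omega), add_zero]
  simp_rw [hsum, mul_one, sum_range_sub_one_sub]
  have hn : ((n : ℕ) : ℝ) ≠ 0 := by exact_mod_cast n.ne_zero
  congr 1
  simp only [lt_irrefl, if_false]
  field_simp
  ring

theorem blockMean_neg (n : ℕ+) :
    blockMean (fun x => if x < 0 then 1 else 0) n = ENNReal.ofReal (((n : ℝ) - 1) / 2) := by
  rw [← blockMean_pos, blockMean, blockMean, Finset.sum_comm]
  congr 1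
  exact Finset.sum_congr rfl fun a _ => Finset.sum_congr rfl fun b _ =>
    if_congr (by omega) rfl rfl

theorem deltaFun_eq_sum (r : ℝ) (n : ℕ+) :
    deltaFun r n = (∑ d ∈ Finset.range n, ((n : ℝ) - 1 - d) * ((d : ℝ) + 1) ^ r) / n := by
  have hn : ((n : ℕ) : ℝ) ≠ 0 := by exact_mod_cast n.ne_zero
  have hI : ∀ f : ℕ → ℝ, ∑ k ∈ Finset.Icc 1 (n : ℕ), f k = ∑ d ∈ Finset.range n, f (d + 1) := by
    intro f
    rw [Finset.range_eq_Ico, Finset.sum_Ico_add' f 0 n 1]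
    rfl
  rw [deltaFun, powerSum, powerSum, hI, hI, eq_div_iff hn, sub_mul, div_mul_cancel₀ _ hn,
    Finset.sum_mul, ← Finset.sum_sub_distrib]
  refine Finset.sum_congr rfl fun d _ => ?_
  have hd : (0 : ℝ) < (d : ℝ) + 1 := by positivity
  push_cast
  rw [Real.rpow_add hd, Real.rpow_one]
  ring

theorem deltaFun_nonneg (r : ℝ) (n : ℕ+) : 0 ≤ deltaFun r n := by
  rw [deltaFun_eq_sum]
  refine div_nonneg (Finset.sum_nonneg fun d hd => mul_nonneg ?_ (by positivity)) (by positivity)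
  have : ((d + 1 : ℕ) : ℝ) ≤ (n : ℕ) := by exact_mod_cast Finset.mem_range.1 hd
  push_cast at this
  linarith

theorem blockMean_abs_rpow {r : ℝ} (hr : 0 < r) (n : ℕ+) :
    blockMean (fun x => ENNReal.ofReal (|(x : ℝ)| ^ r)) n = 2 * ENNReal.ofReal (deltaFun r n) := by
  rw [blockMean_ofReal (f := fun x => |(x : ℝ)| ^ r) (fun x => by positivity)]
  have h2 : (2 : ℝ≥0∞) = ENNReal.ofReal 2 := by simp
  rw [h2, ← ENNReal.ofReal_mul (by norm_num), deltaFun_eq_sum]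
  congr 1
  rw [Int.cast_zero, abs_zero, Real.zero_rpow hr.ne', mul_zero, zero_add, ← mul_div_assoc,
    Finset.mul_sum]
  congr 1
  refine Finset.sum_congr rfl fun d _ => ?_
  have hd : (0 : ℝ) ≤ (d : ℝ) + 1 := by positivity
  push_cast
  rw [abs_neg, abs_of_nonneg hd]
  ring

theorem powerSum_natCast (r n : ℕ) : powerSum r n = ∑ k ∈ Finset.Icc 1 n, (k : ℝ) ^ r := by
  simp [powerSum]

theorem deltaFun_one (n : ℕ+) : deltaFun 1 n = 1 / 6 * ((n : ℝ) ^ 2 - 1) := by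
  have hn : ((n : ℕ) : ℝ) ≠ 0 := by exact_mod_cast n.ne_zero
  have h1 : ∀ m : ℕ, powerSum 1 m = m * (m + 1) / 2 := fun m => by
    have := powerSum_natCast 1 m
    push_cast at this
    rw [this]
    induction m with
    | zero => simp
    | succ m ih =>
      rw [Finset.sum_Icc_succ_top (by omega), ih (by simpa using powerSum_natCast 1 m)]
      push_cast; ring
  have h2 : ∀ m : ℕ, powerSum (1 + 1) m = m * (m + 1) * (2 * m + 1) / 6 := fun m => by
    have e : ∀ m, powerSum (1 + 1) m = ∑ k ∈ Finset.Icc 1 m, (k : ℝ) ^ 2 := fun m => by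
      rw [← powerSum_natCast]; norm_num
    rw [e]
    induction m with
    | zero => simp
    | succ m ih => rw [Finset.sum_Icc_succ_top (by omega), ih]; push_cast; ring
  rw [deltaFun, h1, h2]
  field_simp
  ring

theorem deltaFun_two (n : ℕ+) : deltaFun 2 n = 1 / 12 * (n : ℝ) * ((n : ℝ) ^ 2 - 1) := by
  have hn : ((n : ℕ) : ℝ) ≠ 0 := by exact_mod_cast n.ne_zero
  have h1 : ∀ m : ℕ, powerSum 2 m = m * (m + 1) * (2 * m + 1) / 6 := fun m => by
    have e : ∀ m, powerSum 2 m = ∑ k ∈ Finset.Icc 1 m, (k : ℝ) ^ 2 := fun m => by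
      rw [← powerSum_natCast]; norm_num
    rw [e]
    induction m with
    | zero => simp
    | succ m ih => rw [Finset.sum_Icc_succ_top (by omega), ih]; push_cast; ring
  have h2 : ∀ m : ℕ, powerSum (2 + 1) m = (m * (m + 1) / 2) ^ 2 := fun m => by
    have e : ∀ m, powerSum (2 + 1) m = ∑ k ∈ Finset.Icc 1 m, (k : ℝ) ^ 3 := fun m => by
      rw [← powerSum_natCast]; norm_num
    rw [e]
    induction m with
    | zero => simp
    | succ m ih => rw [Finset.sum_Icc_succ_top (by omega), ih]; push_cast; ring
  rw [deltaFun, h1, h2]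
  field_simp
  ring

/-- Faulhaber's theorem, with the coefficients needed to find the degree of `δ_r`. -/
theorem exists_polynomial_powerSum {r : ℕ} (hr : 1 ≤ r) : ∃ q : Polynomial ℝ,
    q.natDegree ≤ r + 1 ∧ q.coeff (r + 1) = ((r : ℝ) + 1)⁻¹ ∧ q.coeff 0 = 0 ∧
      ∀ n : ℕ, powerSum r n = q.eval (n : ℝ) := by
  set B : Polynomial ℚ := Polynomial.bernoulli (r + 1)
  set Q : Polynomial ℚ := Polynomial.C ((r : ℚ) + 1)⁻¹ * (B - Polynomial.C (bernoulli (r + 1))) +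
    Polynomial.X ^ r
  have hr1 : (r : ℚ) + 1 ≠ 0 := by positivity
  have hB : B.natDegree ≤ r + 1 := Polynomial.natDegree_le_iff_coeff_eq_zero.2 fun N hN => by
    rw [Polynomial.coeff_bernoulli, if_neg (by omega)]
  have hQ : ∀ n : ℕ, Q.eval (n : ℚ) = ∑ k ∈ Finset.Icc 1 n, (k : ℚ) ^ r := by
    intro n
    have h := Polynomial.sum_range_pow_eq_bernoulli_sub n r
    simp only [Q, B, Polynomial.eval_add, Polynomial.eval_mul, Polynomial.eval_sub,
      Polynomial.eval_C, Polynomial.eval_pow, Polynomial.eval_X]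
    rw [← Nat.succ_eq_add_one, ← h, inv_mul_cancel_left₀ hr1, ← Finset.sum_range_succ,
      Finset.sum_range_succ', Nat.cast_zero, zero_pow (by omega), add_zero,
      Finset.range_eq_Ico, Finset.sum_Ico_add' (fun k : ℕ => (k : ℚ) ^ r) 0 n 1]
    rfl
  refine ⟨Q.map (algebraMap ℚ ℝ), Polynomial.natDegree_map_le.trans ?_, ?_, ?_, fun n => ?_⟩
  · refine Polynomial.natDegree_add_le_of_degree_le ?_ ?_
    · refine (Polynomial.natDegree_C_mul_le _ _).trans ?_
      exact (Polynomial.natDegree_sub_C).trans_le hB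
    · exact (Polynomial.natDegree_X_pow_le r).trans (by omega)
  · rw [Polynomial.coeff_map]
    simp only [Q, B, Polynomial.coeff_add, Polynomial.coeff_C_mul, Polynomial.coeff_sub,
      Polynomial.coeff_bernoulli, Polynomial.coeff_C, Polynomial.coeff_X_pow]
    simp
  · rw [Polynomial.coeff_map]
    simp only [Q, B, Polynomial.coeff_add, Polynomial.coeff_C_mul, Polynomial.coeff_sub,
      Polynomial.coeff_bernoulli, Polynomial.coeff_C, Polynomial.coeff_X_pow]
    simp; omega
  · rw [powerSum_natCast, ← map_natCast (algebraMap ℚ ℝ) n, Polynomial.eval_map_algebraMap,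
      Polynomial.aeval_algebraMap_apply, Polynomial.coe_aeval_eq_eval, hQ]
    simp

theorem exists_polynomial_deltaFun {r : ℕ} (hr : 1 ≤ r) : ∃ q : Polynomial ℝ,
    q.natDegree = r + 1 ∧ ∀ n : ℕ+, deltaFun r n = q.eval (n : ℝ) := by
  obtain ⟨q₁, hd₁, hl₁, -, he₁⟩ := exists_polynomial_powerSum hr
  obtain ⟨q₂, hd₂, hl₂, hz₂, he₂⟩ := exists_polynomial_powerSum (r := r + 1) (by omega)
  refine ⟨q₁ - q₂.divX, Polynomial.natDegree_eq_of_le_of_coeff_ne_zero ?_ ?_, fun n => ?_⟩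
  · refine (Polynomial.natDegree_sub_le_of_le hd₁ (?_ : _ ≤ r + 1)).trans (by simp)
    rw [Polynomial.natDegree_divX_eq_natDegree_tsub_one]
    omega
  · rw [Polynomial.coeff_sub, Polynomial.coeff_divX, hl₁, hl₂]
    -- The leading coefficients `1 / (r + 1)` and `1 / (r + 2)` differ.
    have h1 : (r : ℝ) + 1 ≠ 0 := by positivity
    have h2 : ((r + 1 : ℕ) : ℝ) + 1 ≠ 0 := by positivity
    intro h
    rw [sub_eq_zero, inv_inj] at h
    push_cast at h
    linarith
  · have hn : ((n : ℕ) : ℝ) ≠ 0 := by exact_mod_cast n.ne_zero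
    have h := congrArg (Polynomial.eval ((n : ℕ) : ℝ)) q₂.divX_mul_X_add
    rw [hz₂] at h
    simp only [Polynomial.eval_mul, Polynomial.eval_X, map_zero, add_zero] at h
    have he₂' := he₂ n
    push_cast at he₂'
    rw [deltaFun, he₁, he₂', ← h, mul_div_cancel_right₀ _ hn, Polynomial.eval_sub]

theorem deltaFun_le {r : ℝ} (hr : 0 < r) (n : ℕ+) : deltaFun r n ≤ (n : ℝ) ^ (r + 1) := by
  have hn : (0 : ℝ) < (n : ℕ) := by exact_mod_cast n.pos
  rw [deltaFun_eq_sum, div_le_iff₀ hn, Real.rpow_add hn, Real.rpow_one]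
  have h : ∀ d ∈ Finset.range (n : ℕ), ((n : ℝ) - 1 - d) * ((d : ℝ) + 1) ^ r ≤ n * (n : ℝ) ^ r := by
    intro d hd
    have h1 : ((d + 1 : ℕ) : ℝ) ≤ (n : ℕ) := by exact_mod_cast Finset.mem_range.1 hd
    push_cast at h1
    have hd0 : (0 : ℝ) ≤ d := Nat.cast_nonneg d
    exact mul_le_mul (by linarith) (Real.rpow_le_rpow (by positivity) h1 hr.le) (by positivity)
      hn.le
  refine (Finset.sum_le_card_nsmul _ _ _ h).trans_eq ?_
  rw [Finset.card_range, nsmul_eq_mul]; ring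

/-- Symmetrizing `∑ (n - d) d ^ r` under `d ↦ n - d` and bounding the larger of `d`, `n - d` below by `n / 2`
reduces a lower bound on `δ_r` to the formula for `δ_1`. -/
theorem rpow_le_deltaFun {r : ℝ} (hr : 0 < r) (n : ℕ+) :
    (n : ℝ) ^ (r + 1) ≤ 1 + 16 * 2 ^ r * deltaFun r n := by
  rcases eq_or_ne n 1 with rfl | hn1
  · have := deltaFun_nonneg r 1
    simp only [PNat.one_coe, Nat.cast_one, Real.one_rpow]
    have : 0 ≤ 16 * (2 : ℝ) ^ r * deltaFun r 1 := by positivity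
    linarith
  have hn2 : (2 : ℝ) ≤ (n : ℕ) := by
    have h1 : (n : ℕ) ≠ 1 := fun h => hn1 (PNat.eq h)
    have h2 := n.pos
    exact_mod_cast (by omega : 2 ≤ (n : ℕ))
  obtain ⟨m, hm⟩ : ∃ m : ℕ, (n : ℕ) = m + 1 := ⟨n - 1, by have := n.pos; omega⟩
  have hmR : ((n : ℕ) : ℝ) = m + 1 := by exact_mod_cast hm
  set N : ℝ := ((n : ℕ) : ℝ)
  have hN : 0 < N := by linarith
  have hform : ∀ s : ℝ, deltaFun s n * N =
      ∑ d ∈ Finset.range m, ((m : ℝ) - d) * ((d : ℝ) + 1) ^ s := by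
    intro s
    rw [deltaFun_eq_sum, div_mul_cancel₀ _ hN.ne', hm, Finset.sum_range_succ]
    simp
  have hrefl : ∀ s : ℝ, deltaFun s n * N =
      ∑ d ∈ Finset.range m, ((d : ℝ) + 1) * ((m : ℝ) - d) ^ s := by
    intro s
    rw [hform, ← Finset.sum_range_reflect]
    refine Finset.sum_congr rfl fun d hd => ?_
    have := Finset.mem_range.1 hd
    rw [Nat.sub_sub, Nat.cast_sub (by omega)]
    push_cast
    congr 2 <;> ring
  have hkey : ∀ x y : ℝ, 0 < x → 0 < y → x + y = N →
      (N / 2) ^ r / N * (y * x) ≤ y * x ^ r + x * y ^ r := by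
    have aux : ∀ x y : ℝ, 0 < x → 0 < y → x + y = N → y ≤ x →
        (N / 2) ^ r / N * (y * x) ≤ y * x ^ r := by
      intro x y hx hy hxy hle
      have h1 : (N / 2) ^ r ≤ x ^ r := Real.rpow_le_rpow (by positivity) (by linarith) hr.le
      have h2 : x / N ≤ 1 := (div_le_one hN).2 (by linarith)
      calc (N / 2) ^ r / N * (y * x) = y * ((N / 2) ^ r * (x / N)) := by ring
        _ ≤ y * (x ^ r * 1) := by gcongr
        _ = y * x ^ r := by ring
    intro x y hx hy hxy
    rcases le_total y x with h | h
    · have := aux x y hx hy hxy h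
      have h3 : 0 ≤ x * y ^ r := by positivity
      linarith
    · have := aux y x hy hx (by linarith) h
      have h3 : 0 ≤ y * x ^ r := by positivity
      rw [mul_comm y x]
      linarith
  have h2 : (N / 2) ^ r / N * (deltaFun 1 n * N) ≤ 2 * (deltaFun r n * N) := by
    rw [two_mul, hform 1]
    -- One copy of `δ_r` is written forwards and the other one backwards.
    nth_rewrite 1 [hform r]
    rw [hrefl r, Finset.mul_sum, ← Finset.sum_add_distrib]
    refine Finset.sum_le_sum fun d hd => ?_
    have h1 : ((d + 1 : ℕ) : ℝ) ≤ m := by exact_mod_cast Finset.mem_range.1 hd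
    push_cast at h1
    rw [Real.rpow_one]
    exact hkey _ _ (by positivity) (by linarith) (by rw [hmR]; ring)
  rw [deltaFun_one] at h2
  have h3 : (N / 2) ^ r = N ^ r / 2 ^ r := Real.div_rpow hN.le (by norm_num) r
  rw [h3] at h2
  have h2r : (0 : ℝ) < 2 ^ r := by positivity
  have hNr : (0 : ℝ) < N ^ r := by positivity
  have h4 : N ^ r * (N ^ 2 - 1) ≤ 12 * 2 ^ r * (deltaFun r n * N) := by
    have h5 : N ^ r / 2 ^ r / N * (1 / 6 * (N ^ 2 - 1) * N) =
        (N ^ r * (N ^ 2 - 1)) / (6 * 2 ^ r) := by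
      field_simp
    rw [h5, div_le_iff₀ (by positivity)] at h2
    linarith
  have h6 : N ^ r * (3 / 4 * N) * N ≤ 12 * 2 ^ r * deltaFun r n * N := by
    have : N ^ r * (3 / 4 * N * N) ≤ N ^ r * (N ^ 2 - 1) := by
      gcongr
      nlinarith
    linarith
  have h7 := le_of_mul_le_mul_right h6 hN
  rw [Real.rpow_add hN, Real.rpow_one]
  linarith

/-! ### The sequence of blocks -/

/-- A block up to translation: its length and its reduced permutation. -/
abbrev BlockType : Type := Σ n : ℕ+, Equiv.Perm (Fin n)

/-- All sets of block types are measurable; there are countably many block types. -/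
instance : MeasurableSpace BlockType := ⊤

/-- The discrete σ-algebra, for which `Y k : Ω → ℕ+` is measurable if and only if its cast to `ℕ` is. -/
instance : MeasurableSpace ℕ+ := ⊤

/-- The probability of a block type: a length from `p`, then a permutation from `Q`. -/
noncomputable def blockMass (p : PMF ℕ+) (Q : ∀ n : ℕ+, PMF (Equiv.Perm (Fin n)))
    (b : BlockType) : ℝ≥0∞ := p b.1 * Q b.1 b.2

open Classical in
/-- The type of the block between the renewal times with indices `k` and `k + 1`; the reduced permutation
is a default value on the null set on which the permutation does not split at these times. -/
noncomputable def block {Ω : Type*} (Per : Ω → Equiv.Perm ℕ+) (T₀ : Ω → ℕ) (Y : ℕ → Ω → ℕ+)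
    (k : ℕ) (ω : Ω) : BlockType :=
  ⟨Y k ω, if h : ∃ σ, ReducedBlockIs (Per ω) (renewalTime T₀ Y k ω) (Y k ω) σ then h.choose else 1⟩

section RenewalTimes

variable {Ω : Type*} {T₀ : Ω → ℕ} {Y : ℕ → Ω → ℕ+}

theorem renewalTime_succ (k : ℕ) (ω : Ω) :
    renewalTime T₀ Y (k + 1) ω = renewalTime T₀ Y k ω + Y k ω := by
  simp [renewalTime, Finset.sum_range_succ, add_assoc]

theorem renewalTime_strictMono (ω : Ω) : StrictMono fun k => renewalTime T₀ Y k ω :=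
  strictMono_nat_of_lt_succ fun k => by
    have := (Y k ω).pos
    rw [renewalTime_succ]; omega

theorem renewalTime_zero (ω : Ω) : renewalTime T₀ Y 0 ω = T₀ ω := by simp [renewalTime]

/-- Every `n > T₀` lies in exactly one block with index at least one. -/
theorem existsUnique_block_mem {n : ℕ} {ω : Ω} (h : T₀ ω < n) :
    ∃! k, renewalTime T₀ Y k ω < n ∧ n ≤ renewalTime T₀ Y (k + 1) ω := by
  have hmono := renewalTime_strictMono (T₀ := T₀) (Y := Y) ω
  have hex : ∃ k, n ≤ renewalTime T₀ Y k ω := ⟨n, hmono.le_apply⟩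
  classical
  obtain ⟨k, hk⟩ : ∃ k, Nat.find hex = k + 1 := Nat.exists_eq_succ_of_ne_zero fun h0 => by
    have := Nat.find_spec hex
    rw [h0, renewalTime_zero] at this
    omega
  have h1 := Nat.find_spec hex
  have h2 := Nat.find_min hex (m := k) (by omega)
  rw [hk] at h1
  refine ⟨k, ⟨not_le.1 h2, h1⟩, fun j hj => ?_⟩
  have h3 : j < k + 1 := hmono.lt_iff_lt.1 (hj.1.trans_le h1)
  have h4 : k < j + 1 := hmono.lt_iff_lt.1 ((not_le.1 h2).trans_le hj.2)
  omega

end RenewalTimes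

section Blocks

variable {Ω : Type*} [MeasurableSpace Ω] {P : Measure Ω}
  {Per : Ω → Equiv.Perm ℕ+} {T₀ : Ω → ℕ} {Y : ℕ → Ω → ℕ+} {p : PMF ℕ+}
  {Q : ∀ n : ℕ+, PMF (Equiv.Perm (Fin n))}

theorem measurable_toPNat {f : Ω → ℕ+} (h : Measurable fun ω => (f ω : ℕ)) : Measurable f :=
  measurable_to_countable' fun n => by
    have : f ⁻¹' {n} = (fun ω => (f ω : ℕ)) ⁻¹' {(n : ℕ)} := by ext; simp
    rw [this]
    exact h (measurableSet_singleton _)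

namespace IsRecurrentRegenerative

variable (h : IsRecurrentRegenerative P Per T₀ Y p Q)
include h

theorem measurable_Y (k : ℕ) : Measurable (Y k) := measurable_toPNat (h.measurable_length k)

theorem measurable_Per (i : ℕ+) : Measurable fun ω => Per ω i :=
  measurable_toPNat (h.measurable_perm i)

theorem measurable_renewalTime (k : ℕ) : Measurable (renewalTime T₀ Y k) :=
  h.measurable_delay.add (Finset.measurable_fun_sum _ fun i _ => h.measurable_length i)

theorem measurableSet_renewalAt (n : ℕ) : MeasurableSet {ω | RenewalAt T₀ Y n ω} := by
  have : {ω | RenewalAt T₀ Y n ω} = ⋃ k, renewalTime T₀ Y k ⁻¹' {n} := by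
    ext ω; simp [RenewalAt]
  rw [this]
  exact MeasurableSet.iUnion fun k => h.measurable_renewalTime k (measurableSet_singleton n)

theorem measurableSet_reducedBlockIs (k n : ℕ) (σ : Equiv.Perm (Fin n)) :
    MeasurableSet {ω | ReducedBlockIs (Per ω) (renewalTime T₀ Y k ω) n σ} := by
  have : {ω | ReducedBlockIs (Per ω) (renewalTime T₀ Y k ω) n σ} =
      ⋃ t, (renewalTime T₀ Y k ⁻¹' {t} ∩ ⋂ j : Fin n,
        (fun ω => Per ω (Nat.succPNat (t + j))) ⁻¹' {Nat.succPNat (t + σ j)}) := by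
    ext ω; simp [ReducedBlockIs]
  rw [this]
  exact MeasurableSet.iUnion fun t => (h.measurable_renewalTime k (measurableSet_singleton t)).inter
    (MeasurableSet.iInter fun j => h.measurable_Per _ (measurableSet_singleton _))

theorem measurable_block (k : ℕ) : Measurable (block Per T₀ Y k) := by
  classical
  refine measurable_to_countable' fun ⟨n, σ⟩ => ?_
  have : block Per T₀ Y k ⁻¹' {⟨n, σ⟩} = Y k ⁻¹' {n} ∩
      ({ω | ReducedBlockIs (Per ω) (renewalTime T₀ Y k ω) n σ} ∪
        {ω | σ = 1 ∧ ¬ ∃ τ : Equiv.Perm (Fin n),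
          ReducedBlockIs (Per ω) (renewalTime T₀ Y k ω) n τ}) := by
    ext ω
    simp only [block, Set.mem_preimage, Set.mem_singleton_iff, Set.mem_inter_iff, Set.mem_union,
      Set.mem_ofPred_eq]
    by_cases hY : Y k ω = n
    · subst hY
      simp only [Sigma.mk.injEq, heq_eq_eq, true_and]
      split_ifs with hex
      · constructor
        · rintro rfl
          exact Or.inl hex.choose_spec
        · rintro (h1 | ⟨-, h2⟩)
          · exact hex.choose_spec.unique h1
          · exact absurd hex h2
      · constructor
        · rintro rfl
          exact Or.inr ⟨rfl, hex⟩
        · rintro (h1 | ⟨h2, -⟩)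
          · exact absurd ⟨_, h1⟩ hex
          · exact h2.symm
    · constructor
      · intro h1
        exact absurd (congrArg Sigma.fst h1) hY
      · exact fun h1 => absurd h1.1 hY
  rw [this]
  refine (h.measurable_Y k (measurableSet_singleton n)).inter
    ((h.measurableSet_reducedBlockIs k n σ).union ?_)
  have h2 : {ω | σ = 1 ∧ ¬ ∃ τ : Equiv.Perm (Fin n),
      ReducedBlockIs (Per ω) (renewalTime T₀ Y k ω) n τ} = {_ω | σ = 1} ∩
      (⋃ τ : Equiv.Perm (Fin n),
        {ω | ReducedBlockIs (Per ω) (renewalTime T₀ Y k ω) n τ})ᶜ := by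
    ext ω; simp
  rw [h2]
  exact (MeasurableSet.const _).inter
    (MeasurableSet.iUnion fun τ => h.measurableSet_reducedBlockIs k n τ).compl

theorem ae_reducedBlockIs : ∀ᵐ ω ∂P, ∀ k, ReducedBlockIs (Per ω) (renewalTime T₀ Y k ω)
    (Y k ω) (block Per T₀ Y k ω).2 := by
  filter_upwards [h.splits] with ω hω k
  have h1 := hω (k + 1)
  rw [renewalTime_succ] at h1
  have hex := exists_reducedBlockIs (hω k) h1
  simp only [block]
  rw [dif_pos hex]
  exact hex.choose_spec

theorem measure_delay_lengths (m t : ℕ) (n : Fin m → ℕ+) :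
    P {ω | T₀ ω = t ∧ ∀ i : Fin m, Y i ω = n i} = P {ω | T₀ ω = t} * ∏ i, p (n i) := by
  have h1 := h.indep_delay.measure_inter_preimage_eq_mul {t} {f | ∀ i : Fin m, f i = (n i : ℕ)}
    (measurableSet_singleton t) (by
      have : {f : ℕ → ℕ | ∀ i : Fin m, f i = (n i : ℕ)} =
          ⋂ i : Fin m, (fun f : ℕ → ℕ => f i) ⁻¹' {(n i : ℕ)} := by ext; simp
      rw [this]
      exact MeasurableSet.iInter fun i => measurable_pi_apply _ (measurableSet_singleton _))
  have h2 := h.indep_length.measure_inter_preimage_eq_mul (S := Finset.range m)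
    (sets := fun i => if hi : i < m then {((n ⟨i, hi⟩ : ℕ+) : ℕ)} else Set.univ)
    (fun i _ => MeasurableSet.of_discrete)
  have e1 : {ω | T₀ ω = t ∧ ∀ i : Fin m, Y i ω = n i} = T₀ ⁻¹' {t} ∩
      (fun ω i => (Y i ω : ℕ)) ⁻¹' {f | ∀ i : Fin m, f i = (n i : ℕ)} := by
    ext ω; simp
  have e2 : (fun ω i => (Y i ω : ℕ)) ⁻¹' {f : ℕ → ℕ | ∀ i : Fin m, f i = (n i : ℕ)} =
      ⋂ i ∈ Finset.range m, (fun ω => (Y i ω : ℕ)) ⁻¹'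
        (if hi : i < m then {((n ⟨i, hi⟩ : ℕ+) : ℕ)} else Set.univ) := by
    ext ω
    simp only [Set.mem_preimage, Set.mem_ofPred_eq, Set.mem_iInter, Finset.mem_range]
    constructor
    · intro hω i hi
      rw [dif_pos hi]
      exact hω ⟨i, hi⟩
    · intro hω i
      have := hω i i.2
      rw [dif_pos i.2] at this
      exact this
  rw [e1, h1, e2, h2, Finset.prod_range]
  congr 1
  refine Finset.prod_congr rfl fun i _ => ?_
  rw [dif_pos i.2, ← h.law_length i (n i)]
  congr 1
  ext ω; simp

/-- The joint law of the delay and of the first `m` blocks. On the event in `law_blocks` the block type is the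
prescribed one, and conversely, outside the null set on which some renewal time does not split. -/
theorem measure_delay_blocks (m t : ℕ) (b : Fin m → BlockType) :
    P {ω | T₀ ω = t ∧ ∀ i : Fin m, block Per T₀ Y i ω = b i} =
      P {ω | T₀ ω = t} * ∏ i, blockMass p Q (b i) := by
  have h1 := h.law_blocks m t (fun i => (b i).1) (fun i => (b i).2)
  rw [h.measure_delay_lengths, mul_assoc, ← Finset.prod_mul_distrib] at h1
  rw [show ∏ i, blockMass p Q (b i) = ∏ i, p (b i).1 * Q (b i).1 (b i).2 from rfl, ← h1]
  refine measure_congr ?_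
  filter_upwards [h.ae_reducedBlockIs] with ω hω
  refine propext (and_congr_right fun _ => forall_congr' fun i => ?_)
  generalize b i = c
  obtain ⟨n, σ⟩ := c
  constructor
  · intro hc
    have h2 : Y i ω = n := congrArg Sigma.fst hc
    subst h2
    refine ⟨rfl, ?_⟩
    have h3 : (block Per T₀ Y i ω).2 = σ := eq_of_heq (Sigma.mk.inj hc).2
    exact h3 ▸ hω i
  · rintro ⟨h2, h3⟩
    simp only at h2
    subst h2
    exact Sigma.ext rfl (heq_of_eq ((hω i).unique h3))

/-- The product formula for the delay and the first `k` blocks on the one hand and the next block on the other. -/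
theorem measure_past_block (k : ℕ) (w : ℕ × (Fin k → BlockType)) (b : BlockType) :
    P {ω | (T₀ ω, fun i : Fin k => block Per T₀ Y i ω) = w ∧ block Per T₀ Y k ω = b} =
      P {ω | (T₀ ω, fun i : Fin k => block Per T₀ Y i ω) = w} * blockMass p Q b := by
  obtain ⟨t, c⟩ := w
  have h1 := h.measure_delay_blocks k t c
  have h2 := h.measure_delay_blocks (k + 1) t (Fin.snoc c b)
  rw [Fin.prod_univ_castSucc] at h2
  simp only [Fin.snoc_castSucc, Fin.snoc_last] at h2
  rw [← mul_assoc, ← h1] at h2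
  have e1 : {ω | (T₀ ω, fun i : Fin k => block Per T₀ Y i ω) = (t, c)} =
      {ω | T₀ ω = t ∧ ∀ i : Fin k, block Per T₀ Y i ω = c i} := by
    ext ω; simp [funext_iff]
  rw [e1, ← h2]
  congr 1
  ext ω
  simp only [Prod.mk.injEq, funext_iff, Set.mem_ofPred_eq, Fin.forall_fin_succ', Fin.snoc_castSucc,
    Fin.snoc_last, Fin.val_castSucc, Fin.val_last, and_assoc]

theorem measurable_past (k : ℕ) :
    Measurable fun ω => (T₀ ω, fun i : Fin k => block Per T₀ Y i ω) :=
  h.measurable_delay.prodMk (measurable_pi_lambda _ fun i => h.measurable_block i)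

theorem measure_block [IsProbabilityMeasure P] (k : ℕ) (b : BlockType) :
    P {ω | block Per T₀ Y k ω = b} = blockMass p Q b := by
  have hmeas : (P.restrict {ω | block Per T₀ Y k ω = b}).map
      (fun ω => (T₀ ω, fun i : Fin k => block Per T₀ Y i ω)) =
      blockMass p Q b • P.map (fun ω => (T₀ ω, fun i : Fin k => block Per T₀ Y i ω)) := by
    refine Measure.ext_of_singleton fun w => ?_
    have hw := h.measurable_past k (measurableSet_singleton w)
    rw [Measure.map_apply (h.measurable_past k) (measurableSet_singleton w),
      Measure.restrict_apply hw, Measure.smul_apply,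
      Measure.map_apply (h.measurable_past k) (measurableSet_singleton w), smul_eq_mul, mul_comm]
    exact h.measure_past_block k w b
  have h1 := congrArg (fun ν => ν Set.univ) hmeas
  simp only [Measure.smul_apply, smul_eq_mul] at h1
  rw [Measure.map_apply (h.measurable_past k) MeasurableSet.univ,
    Measure.map_apply (h.measurable_past k) MeasurableSet.univ] at h1
  simpa using h1

/-- Each block is independent of the delay and of all earlier blocks. -/
theorem indepFun_past_block [IsProbabilityMeasure P] (k : ℕ) :
    IndepFun (fun ω => (T₀ ω, fun i : Fin k => block Per T₀ Y i ω)) (block Per T₀ Y k) P := by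
  rw [indepFun_iff_map_prod_eq_prod_map_map (h.measurable_past k).aemeasurable
    (h.measurable_block k).aemeasurable]
  refine Measure.ext_of_singleton fun ⟨w, b⟩ => ?_
  rw [← Set.singleton_prod_singleton, Measure.prod_prod,
    Measure.map_apply (h.measurable_past k) (measurableSet_singleton w),
    Measure.map_apply (h.measurable_block k) (measurableSet_singleton b),
    Measure.map_apply ((h.measurable_past k).prodMk (h.measurable_block k))
      ((measurableSet_singleton w).prod (measurableSet_singleton b))]
  have h1 := h.measure_past_block k w b
  rw [← h.measure_block k b] at h1
  exact h1

theorem indepFun_renewalTime_block [IsProbabilityMeasure P] (k : ℕ) :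
    IndepFun (renewalTime T₀ Y k) (block Per T₀ Y k) P := by
  have := (h.indepFun_past_block k).comp
    (φ := fun w : ℕ × (Fin k → BlockType) => w.1 + ∑ i, ((w.2 i).1 : ℕ)) (ψ := id)
    (Measurable.of_discrete) measurable_id
  rw [show renewalTime T₀ Y k = (fun w : ℕ × (Fin k → BlockType) => w.1 + ∑ i, ((w.2 i).1 : ℕ)) ∘
    fun ω => (T₀ ω, fun i : Fin k => block Per T₀ Y i ω) by
      funext ω; simp [renewalTime, block, Finset.sum_range]]
  exact this

theorem indepFun_block [IsProbabilityMeasure P] {i k : ℕ} (hik : i < k) :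
    IndepFun (block Per T₀ Y i) (block Per T₀ Y k) P :=
  (h.indepFun_past_block k).comp
    (φ := fun w : ℕ × (Fin k → BlockType) => w.2 ⟨i, hik⟩) (ψ := id)
    (Measurable.of_discrete) measurable_id

theorem identDistrib_block [IsProbabilityMeasure P] (k : ℕ) :
    IdentDistrib (block Per T₀ Y k) (block Per T₀ Y 0) P P :=
  ⟨(h.measurable_block k).aemeasurable, (h.measurable_block 0).aemeasurable,
    Measure.ext_of_singleton fun b => by
      rw [Measure.map_apply (h.measurable_block k) (measurableSet_singleton b),
        Measure.map_apply (h.measurable_block 0) (measurableSet_singleton b)]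
      exact (h.measure_block k b).trans (h.measure_block 0 b).symm⟩

theorem lintegral_block [IsProbabilityMeasure P] (ψ : BlockType → ℝ≥0∞) (k : ℕ) :
    ∫⁻ ω, ψ (block Per T₀ Y k ω) ∂P =
      ∑' n : ℕ+, p n * ∑ σ : Equiv.Perm (Fin n), Q n σ * ψ ⟨n, σ⟩ := by
  rw [← lintegral_map (f := ψ) (Measurable.of_discrete) (h.measurable_block k),
    lintegral_countable', ENNReal.tsum_sigma']
  refine tsum_congr fun n => ?_
  rw [tsum_fintype, Finset.mul_sum]
  refine Finset.sum_congr rfl fun σ _ => ?_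
  rw [Measure.map_apply (h.measurable_block k) (measurableSet_singleton _)]
  have : P (block Per T₀ Y k ⁻¹' {⟨n, σ⟩}) = p n * Q n σ := h.measure_block k ⟨n, σ⟩
  rw [this]
  ring

theorem lintegral_length (f : ℕ+ → ℝ≥0∞) (k : ℕ) :
    ∫⁻ ω, f (Y k ω) ∂P = ∑' n : ℕ+, p n * f n := by
  rw [← lintegral_map (f := f) (Measurable.of_discrete) (h.measurable_Y k),
    lintegral_countable']
  refine tsum_congr fun n => ?_
  rw [Measure.map_apply (h.measurable_Y k) (measurableSet_singleton _), mul_comm]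
  congr 1
  exact h.law_length k n

theorem meanLength_eq_lintegral (k : ℕ) : meanLength p = ∫⁻ ω, ((Y k ω : ℕ) : ℝ≥0∞) ∂P := by
  rw [h.lintegral_length (fun n => ((n : ℕ) : ℝ≥0∞)), meanLength]
  exact tsum_congr fun n => mul_comm _ _

theorem measure_renewalAt (n : ℕ) :
    P {ω | RenewalAt T₀ Y n ω} = ∑' k, P {ω | renewalTime T₀ Y k ω = n} := by
  have : {ω | RenewalAt T₀ Y n ω} = ⋃ k, {ω | renewalTime T₀ Y k ω = n} := by
    ext ω; simp [RenewalAt]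
  rw [this, measure_iUnion]
  · intro i j hij
    refine Set.disjoint_left.2 fun ω hi hj => hij ?_
    exact (renewalTime_strictMono (T₀ := T₀) (Y := Y) ω).injective (hi.trans hj.symm)
  · exact fun k => h.measurable_renewalTime k (measurableSet_singleton n)

/-- The block following a renewal at `n` is distributed as an unconditioned block. At most one term of the
sum over `k` is nonzero at each sample point. -/
theorem tsum_lintegral_renewal [IsProbabilityMeasure P] (ψ : BlockType → ℝ≥0∞) (n : ℕ) :
    ∑' k, ∫⁻ ω, (if renewalTime T₀ Y k ω = n then ψ (block Per T₀ Y k ω) else 0) ∂P =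
      P {ω | RenewalAt T₀ Y n ω} * ∫⁻ ω, ψ (block Per T₀ Y 0 ω) ∂P := by
  rw [h.measure_renewalAt, ← ENNReal.tsum_mul_right]
  refine tsum_congr fun k => ?_
  have h1 := lintegral_mul_eq_lintegral_mul_lintegral_of_indepFun (μ := P)
    (f := fun ω => if renewalTime T₀ Y k ω = n then (1 : ℝ≥0∞) else 0)
    (g := fun ω => ψ (block Per T₀ Y k ω))
    ((Measurable.of_discrete (f := fun m : ℕ => if m = n then (1 : ℝ≥0∞) else 0)).comp
      (h.measurable_renewalTime k))
    ((Measurable.of_discrete (f := ψ)).comp (h.measurable_block k))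
    ((h.indepFun_renewalTime_block k).comp
      (φ := fun m : ℕ => if m = n then (1 : ℝ≥0∞) else 0) (ψ := ψ)
      Measurable.of_discrete Measurable.of_discrete)
  have h2 : ∫⁻ ω, (if renewalTime T₀ Y k ω = n then (1 : ℝ≥0∞) else 0) ∂P =
      P {ω | renewalTime T₀ Y k ω = n} := by
    refine (lintegral_congr fun ω => ?_).trans (lintegral_indicator_one
      (h.measurable_renewalTime k (measurableSet_singleton n)))
    simp [Set.indicator]
  rw [h2, h.lintegral_block ψ k, ← h.lintegral_block ψ 0] at h1
  rw [← h1]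
  refine lintegral_congr fun ω => ?_
  simp

end IsRecurrentRegenerative

end Blocks

/-! ### Cycle counts -/

/-- If `N` is nondecreasing and `N (T k) ~ m k` along times `T k ~ μ k`, then `N n ~ (m / μ) n`. -/
theorem tendsto_div_of_tendsto_subsequence {N : ℕ → ℝ} (hN : Monotone N) (hN0 : ∀ n, 0 ≤ N n)
    {T : ℕ → ℕ} (hT : StrictMono T) {m μ : ℝ} (hμ : 0 < μ)
    (hNT : Tendsto (fun k : ℕ => N (T k) / k) atTop (𝓝 m))
    (hTk : Tendsto (fun k : ℕ => (T k : ℝ) / k) atTop (𝓝 μ)) :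
    Tendsto (fun n : ℕ => N n / n) atTop (𝓝 (m / μ)) := by
  have hex : ∀ n, ∃ k, T 0 ≤ n → T k ≤ n ∧ n < T (k + 1) := by
    intro n
    by_cases h0 : T 0 ≤ n
    · have hfin : ∃ k, n < T k := ⟨n + 1, Nat.lt_of_succ_le hT.le_apply⟩
      classical
      obtain ⟨k, hk⟩ : ∃ k, Nat.find hfin = k + 1 := Nat.exists_eq_succ_of_ne_zero fun h1 => by
        have := Nat.find_spec hfin
        rw [h1] at this
        omega
      have h1 := Nat.find_spec hfin
      rw [hk] at h1
      exact ⟨k, fun _ => ⟨not_lt.1 (Nat.find_min hfin (m := k) (by omega)), h1⟩⟩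
    · exact ⟨0, fun h => absurd h h0⟩
  -- `K n` is the index with `T (K n) ≤ n < T (K n + 1)`.
  choose K hK using hex
  have hKtop : Tendsto K atTop atTop := by
    refine tendsto_atTop.2 fun b => ?_
    filter_upwards [eventually_ge_atTop (T 0), eventually_ge_atTop (T b)] with n h0 hb
    have := hT.lt_iff_lt.1 (hb.trans_lt (hK n h0).2)
    omega
  have hk1 : Tendsto (fun k : ℕ => ((k : ℝ) + 1) / k) atTop (𝓝 1) := by
    have h1 : Tendsto (fun k : ℕ => 1 + (1 : ℝ) / k) atTop (𝓝 (1 + 0)) :=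
      tendsto_const_nhds.add tendsto_one_div_atTop_nhds_zero_nat
    rw [add_zero] at h1
    refine h1.congr' ?_
    filter_upwards [eventually_gt_atTop 0] with k hk
    have : (k : ℝ) ≠ 0 := by exact_mod_cast hk.ne'
    field_simp
  have hTk1 : Tendsto (fun k : ℕ => (T (k + 1) : ℝ) / k) atTop (𝓝 μ) := by
    have h1 := (hTk.comp (tendsto_add_atTop_nat 1)).mul hk1
    rw [mul_one] at h1
    refine h1.congr fun k => ?_
    simp only [Function.comp]
    push_cast
    have : (k : ℝ) + 1 ≠ 0 := by positivity
    field_simp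
  have hNT1 : Tendsto (fun k : ℕ => N (T (k + 1)) / k) atTop (𝓝 m) := by
    have h1 := (hNT.comp (tendsto_add_atTop_nat 1)).mul hk1
    rw [mul_one] at h1
    refine h1.congr fun k => ?_
    simp only [Function.comp]
    push_cast
    have : (k : ℝ) + 1 ≠ 0 := by positivity
    field_simp
  have hlow : Tendsto (fun k : ℕ => N (T k) / T (k + 1)) atTop (𝓝 (m / μ)) := by
    refine (hNT.div hTk1 hμ.ne').congr' ?_
    filter_upwards [eventually_gt_atTop 0] with k hk
    simp only [Pi.div_apply]
    have : (k : ℝ) ≠ 0 := by exact_mod_cast hk.ne'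
    field_simp
  have hup : Tendsto (fun k : ℕ => N (T (k + 1)) / T k) atTop (𝓝 (m / μ)) := by
    refine (hNT1.div hTk hμ.ne').congr' ?_
    filter_upwards [eventually_gt_atTop 0] with k hk
    simp only [Pi.div_apply]
    have : (k : ℝ) ≠ 0 := by exact_mod_cast hk.ne'
    field_simp
  refine tendsto_of_tendsto_of_tendsto_of_le_of_le' (hlow.comp hKtop) (hup.comp hKtop) ?_ ?_
  · filter_upwards [eventually_ge_atTop (T 0), eventually_gt_atTop 0] with n h0 hn
    have h1 := hK n h0
    have hn' : (0 : ℝ) < n := by exact_mod_cast hn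
    have h2 : (n : ℝ) ≤ T (K n + 1) := by exact_mod_cast h1.2.le
    exact div_le_div₀ (hN0 _) (hN h1.1) hn' h2
  · filter_upwards [eventually_ge_atTop (T 0), hKtop.eventually_gt_atTop 0] with n h0 hKn
    have h1 := hK n h0
    have h2 : (T (K n) : ℝ) ≤ n := by exact_mod_cast h1.1
    have h3 : (0 : ℝ) < T (K n) := by exact_mod_cast (Nat.zero_le _).trans_lt (hT hKn)
    exact div_le_div₀ (hN0 _) (hN h1.2.le) h3 h2

/-- The uniform law of reduced blocks. -/
noncomputable abbrev uniformBlocks (n : ℕ+) : PMF (Equiv.Perm (Fin n)) :=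
  PMF.uniformOfFintype (Equiv.Perm (Fin n))

open Classical in
/-- The expected number of cycles with length satisfying `q` in a uniform permutation of `n` points. -/
noncomputable def cycleMean (q : ℕ → Prop) (n : ℕ) : ℝ :=
  ∑ j ∈ Finset.Icc 1 n, if q j then (j : ℝ)⁻¹ else 0

theorem cycleMean_nonneg (q : ℕ → Prop) (n : ℕ) : 0 ≤ cycleMean q n :=
  Finset.sum_nonneg fun j _ => by split_ifs <;> positivity

open Classical in
theorem cycleMean_le (q : ℕ → Prop) (n : ℕ) : cycleMean q n ≤ n := by
  have h : ∀ j ∈ Finset.Icc 1 n, (if q j then (j : ℝ)⁻¹ else 0) ≤ 1 := by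
    intro j hj
    split_ifs
    · exact inv_le_one_of_one_le₀ (by exact_mod_cast (Finset.mem_Icc.1 hj).1)
    · exact zero_le_one
  simpa [cycleMean] using Finset.sum_le_card_nsmul _ _ _ h

theorem cycleMean_eq {j : ℕ} (hj : 1 ≤ j) (n : ℕ) :
    cycleMean (· = j) n = if j ≤ n then (j : ℝ)⁻¹ else 0 := by
  simp only [cycleMean]
  by_cases hjn : j ≤ n
  · rw [if_pos hjn]
    exact (Finset.sum_eq_single_of_mem j (Finset.mem_Icc.2 ⟨hj, hjn⟩)
      fun i _ hi => if_neg hi).trans (if_pos rfl)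
  · rw [if_neg hjn]
    refine Finset.sum_eq_zero fun i hi => if_neg ?_
    rintro rfl
    exact hjn (Finset.mem_Icc.1 hi).2

theorem cycleMean_true (n : ℕ) : cycleMean (fun _ => True) n = (harmonic n : ℝ) := by
  simp [cycleMean, harmonic_eq_sum_Icc]

theorem sum_uniform_cycleWeight (q : ℕ → Prop) (n : ℕ+) :
    ∑ σ : Equiv.Perm (Fin n), uniformBlocks n σ * ENNReal.ofReal (cycleWeight q σ) =
      ENNReal.ofReal (cycleMean q n) := by
  have hf : ((n : ℕ).factorial : ℝ) ≠ 0 := by exact_mod_cast Nat.factorial_ne_zero _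
  have hf' : (((n : ℕ).factorial : ℕ) : ℝ≥0∞) ≠ 0 := by exact_mod_cast Nat.factorial_ne_zero _
  simp only [uniformBlocks, PMF.uniformOfFintype_apply, Fintype.card_perm, Fintype.card_fin]
  rw [← Finset.mul_sum, ← ENNReal.ofReal_sum_of_nonneg fun σ _ => cycleWeight_nonneg q σ,
    sum_cycleWeight, ENNReal.ofReal_mul (by positivity), ENNReal.ofReal_natCast, ← mul_assoc,
    ENNReal.inv_mul_cancel hf' (ENNReal.natCast_ne_top _), one_mul]
  rfl

theorem tsum_cycleMean_ne_top {p : PMF ℕ+} (hμ : meanLength p ≠ ⊤) (q : ℕ → Prop) :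
    ∑' n : ℕ+, p n * ENNReal.ofReal (cycleMean q n) ≠ ⊤ := by
  refine ne_top_of_le_ne_top hμ (ENNReal.tsum_le_tsum fun n => ?_)
  rw [mul_comm]
  gcongr
  rw [← ENNReal.ofReal_natCast]
  exact ENNReal.ofReal_le_ofReal (cycleMean_le q n)

theorem summable_cycleMean {p : PMF ℕ+} (hμ : meanLength p ≠ ⊤) (q : ℕ → Prop) :
    Summable fun n : ℕ+ => (p n).toReal * cycleMean q n := by
  have := ENNReal.summable_toReal (tsum_cycleMean_ne_top hμ q)
  refine this.congr fun n => ?_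
  rw [ENNReal.toReal_mul, ENNReal.toReal_ofReal (cycleMean_nonneg q n)]

theorem toReal_tsum_cycleMean {p : PMF ℕ+} (hμ : meanLength p ≠ ⊤) (q : ℕ → Prop) :
    (∑' n : ℕ+, p n * ENNReal.ofReal (cycleMean q n)).toReal =
      ∑' n : ℕ+, (p n).toReal * cycleMean q n := by
  rw [ENNReal.tsum_toReal_eq fun n => ENNReal.ne_top_of_tsum_ne_top (tsum_cycleMean_ne_top hμ q) n]
  refine tsum_congr fun n => ?_
  rw [ENNReal.toReal_mul, ENNReal.toReal_ofReal (cycleMean_nonneg q n)]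

namespace IsRecurrentRegenerative

variable {Ω : Type*} [MeasurableSpace Ω] {P : Measure Ω}
  {Per : Ω → Equiv.Perm ℕ+} {T₀ : Ω → ℕ} {Y : ℕ → Ω → ℕ+} {p : PMF ℕ+}

variable (h : IsRecurrentRegenerative P Per T₀ Y p uniformBlocks)
include h

theorem lintegral_cycleWeight [IsProbabilityMeasure P] (q : ℕ → Prop) (k : ℕ) :
    ∫⁻ ω, ENNReal.ofReal (cycleWeight q (block Per T₀ Y k ω).2) ∂P =
      ∑' n : ℕ+, p n * ENNReal.ofReal (cycleMean q n) := by
  rw [h.lintegral_block (fun b => ENNReal.ofReal (cycleWeight q b.2))]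
  exact tsum_congr fun n => by rw [sum_uniform_cycleWeight]

theorem ae_ncard_cyclesIn_block (q : ℕ → Prop) : ∀ᵐ ω ∂P, ∀ k,
    ((cyclesIn (Per ω) q (renewalTime T₀ Y k ω) (renewalTime T₀ Y (k + 1) ω)).ncard : ℝ) =
      cycleWeight q (block Per T₀ Y k ω).2 := by
  filter_upwards [h.ae_reducedBlockIs] with ω hω k
  rw [renewalTime_succ, ncard_cyclesIn_block q (hω k)]
  rfl

theorem lintegral_ncard_cyclesIn [IsProbabilityMeasure P] (q : ℕ → Prop) (k : ℕ) :
    ∫⁻ ω, ((cyclesIn (Per ω) q (renewalTime T₀ Y k ω)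
      (renewalTime T₀ Y (k + 1) ω)).ncard : ℝ≥0∞) ∂P =
      ∑' n : ℕ+, p n * ENNReal.ofReal (cycleMean q n) := by
  rw [← h.lintegral_cycleWeight q k]
  refine lintegral_congr_ae ?_
  filter_upwards [h.ae_ncard_cyclesIn_block q] with ω hω
  rw [← hω k, ENNReal.ofReal_natCast]

/-- The strong law of large numbers for a function of the blocks. -/
theorem strong_law_blocks [IsProbabilityMeasure P] {f : BlockType → ℝ} (hf : ∀ b, 0 ≤ f b)
    (hfin : ∫⁻ ω, ENNReal.ofReal (f (block Per T₀ Y 0 ω)) ∂P ≠ ⊤) :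
    ∀ᵐ ω ∂P, Tendsto (fun k : ℕ => (∑ i ∈ Finset.range k, f (block Per T₀ Y i ω)) / k) atTop
      (𝓝 (∫⁻ ω, ENNReal.ofReal (f (block Per T₀ Y 0 ω)) ∂P).toReal) := by
  have hmeas : Measurable f := Measurable.of_discrete
  have hsm : AEStronglyMeasurable (fun ω => f (block Per T₀ Y 0 ω)) P :=
    (hmeas.comp (h.measurable_block 0)).aestronglyMeasurable
  rw [← integral_eq_lintegral_of_nonneg_ae (Eventually.of_forall fun ω => hf _) hsm]
  refine strong_law_ae_real (fun i ω => f (block Per T₀ Y i ω)) ?_ (fun i k hik => ?_) fun i =>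
    (h.identDistrib_block i).comp hmeas
  · refine ⟨hsm, ?_⟩
    rw [hasFiniteIntegral_iff_ofReal (Eventually.of_forall fun ω => hf _)]
    exact hfin.lt_top
  · rcases lt_or_gt_of_ne hik with h1 | h1
    · exact (h.indepFun_block h1).comp hmeas hmeas
    · exact ((h.indepFun_block h1).comp hmeas hmeas).symm

/-- The strong law of large numbers for the renewal times. -/
theorem ae_tendsto_renewalTime_div [IsProbabilityMeasure P] (hμ : meanLength p ≠ ⊤) :
    ∀ᵐ ω ∂P, Tendsto (fun k : ℕ => (renewalTime T₀ Y k ω : ℝ) / k) atTop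
      (𝓝 (meanLength p).toReal) := by
  have h1 : ∫⁻ ω, ENNReal.ofReal (((block Per T₀ Y 0 ω).1 : ℕ) : ℝ) ∂P = meanLength p := by
    rw [h.meanLength_eq_lintegral 0]
    refine lintegral_congr fun ω => ?_
    rw [ENNReal.ofReal_natCast]
    rfl
  have h2 := h.strong_law_blocks (f := fun b => ((b.1 : ℕ) : ℝ)) (fun b => by positivity)
    (by rw [h1]; exact hμ)
  rw [h1] at h2
  filter_upwards [h2] with ω hω
  have h3 : Tendsto (fun k : ℕ => (T₀ ω : ℝ) / k) atTop (𝓝 0) :=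
    tendsto_const_div_atTop_nhds_zero_nat _
  have h4 := h3.add hω
  rw [zero_add] at h4
  refine h4.congr fun k => ?_
  rw [← add_div, renewalTime]
  push_cast
  rfl

theorem meanLength_toReal_pos [IsProbabilityMeasure P] (hμ : meanLength p ≠ ⊤) : 0 < (meanLength p).toReal := by
  refine ENNReal.toReal_pos (ne_of_gt (lt_of_lt_of_le zero_lt_one ?_)) hμ
  rw [h.meanLength_eq_lintegral 0, ← measure_univ (μ := P), ← lintegral_one]
  exact lintegral_mono fun ω => Nat.one_le_cast.2 (Y 0 ω).pos

/-- The law of large numbers for the number of cycles inside `{1, …, n}` with length satisfying `q`. -/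
theorem ae_tendsto_ncard_cyclesIn [IsProbabilityMeasure P] (hμ : meanLength p ≠ ⊤) (q : ℕ → Prop) :
    ∀ᵐ ω ∂P, Tendsto (fun n : ℕ => ((cyclesIn (Per ω) q 0 n).ncard : ℝ) / n) atTop
      (𝓝 ((∑' n : ℕ+, (p n).toReal * cycleMean q n) / (meanLength p).toReal)) := by
  have h1 := h.strong_law_blocks (f := fun b => cycleWeight q b.2)
    (fun b => cycleWeight_nonneg q _)
    (by rw [h.lintegral_cycleWeight]; exact tsum_cycleMean_ne_top hμ q)
  rw [h.lintegral_cycleWeight, toReal_tsum_cycleMean hμ] at h1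
  filter_upwards [h1, h.ae_tendsto_renewalTime_div hμ, h.ae_ncard_cyclesIn_block q, h.splits]
    with ω h1 h2 h3 h4
  have hmono := renewalTime_strictMono (T₀ := T₀) (Y := Y) ω
  refine tendsto_div_of_tendsto_subsequence (N := fun n => ((cyclesIn (Per ω) q 0 n).ncard : ℝ))
    (fun a b hab => ?_) (fun n => by positivity) hmono (h.meanLength_toReal_pos hμ) ?_ h2
  · exact Nat.cast_le.2
      (Set.ncard_le_ncard (cyclesIn_mono _ q le_rfl hab) (finite_cyclesIn _ q 0 b))
  · have hsum : ∀ k, ((cyclesIn (Per ω) q 0 (renewalTime T₀ Y k ω)).ncard : ℝ) =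
        (cyclesIn (Per ω) q 0 (T₀ ω)).ncard +
          ∑ i ∈ Finset.range k, cycleWeight q (block Per T₀ Y i ω).2 := by
      intro k
      induction k with
      | zero => simp [renewalTime_zero]
      | succ k ih =>
        rw [ncard_cyclesIn_add q (Nat.zero_le _) (hmono k.lt_succ_self).le (h4 k), Nat.cast_add,
          ih, h3, Finset.sum_range_succ, add_assoc]
    have h5 := (tendsto_const_div_atTop_nhds_zero_nat
      ((cyclesIn (Per ω) q 0 (T₀ ω)).ncard : ℝ)).add h1
    rw [zero_add] at h5
    refine h5.congr fun k => ?_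
    rw [hsum, add_div]

theorem measure_length_ge (j : ℕ+) :
    P {ω | j ≤ Y 0 ω} = ∑' n : ℕ+, if j ≤ n then p n else 0 := by
  have h1 := h.lintegral_length (fun n => if j ≤ n then 1 else 0) 0
  have h2 : ∫⁻ ω, (if j ≤ Y 0 ω then (1 : ℝ≥0∞) else 0) ∂P = P {ω | j ≤ Y 0 ω} := by
    refine (lintegral_congr fun ω => ?_).trans (lintegral_indicator_one
      (h.measurable_Y 0 (MeasurableSet.of_discrete (s := Set.Ici j))))
    simp [Set.indicator]
  rw [h2] at h1
  rw [h1]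
  exact tsum_congr fun n => by split_ifs <;> simp

theorem toReal_measure_length_ge (j : ℕ+) :
    (P {ω | j ≤ Y 0 ω}).toReal = ∑' n : ℕ+, if j ≤ n then (p n).toReal else 0 := by
  rw [h.measure_length_ge, ENNReal.tsum_toReal_eq]
  · exact tsum_congr fun n => by split_ifs <;> simp
  · intro n
    split_ifs
    · exact p.apply_ne_top n
    · exact ENNReal.zero_ne_top

/-- The expected number of `j`-cycles in a block is `P(Y ≥ j) / j`. -/
theorem tsum_cycleMean_eq (j : ℕ+) : ∑' n : ℕ+, p n * ENNReal.ofReal (cycleMean (· = (j : ℕ)) n) =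
    P {ω | j ≤ Y 0 ω} / (j : ℕ) := by
  rw [h.measure_length_ge, div_eq_mul_inv, ← ENNReal.tsum_mul_right]
  refine tsum_congr fun n => ?_
  rw [cycleMean_eq j.pos]
  by_cases hjn : j ≤ n
  · rw [if_pos hjn, if_pos (by exact_mod_cast hjn), ENNReal.ofReal_inv_of_pos
      (by exact_mod_cast j.pos), ENNReal.ofReal_natCast]
  · rw [if_neg hjn, if_neg (by exact_mod_cast hjn), ENNReal.ofReal_zero, mul_zero, zero_mul]

theorem cycle_limits [IsProbabilityMeasure P] (hμ : meanLength p ≠ ⊤) (j : ℕ+) :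
    (P {ω | j ≤ Y 0 ω}).toReal = (∑' i : ℕ+, if j ≤ i then (p i).toReal else 0) ∧
      (∀ k : ℕ,
        ∫⁻ ω, (cycleCount (Per ω) (renewalTime T₀ Y k ω) (renewalTime T₀ Y (k + 1) ω) j : ℝ≥0∞) ∂P =
          P {ω | j ≤ Y 0 ω} / (j : ℝ≥0∞)) ∧
      (∀ᵐ ω ∂P, Tendsto (fun n : ℕ => (cycleCount (Per ω) 0 n j : ℝ) / n) atTop
        (𝓝 ((P {ω | j ≤ Y 0 ω}).toReal / (j : ℝ) / (meanLength p).toReal))) ∧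
      Summable (fun i : ℕ+ => (p i).toReal * (harmonic i : ℝ)) ∧
      (∀ᵐ ω ∂P, Tendsto
        (fun n : ℕ => (cycleCount (Per ω) 0 n j : ℝ) / (totalCycleCount (Per ω) 0 n : ℝ)) atTop
        (𝓝 ((∑' i : ℕ+, if j ≤ i then (p i).toReal else 0) /
          ((j : ℝ) * ∑' i : ℕ+, (p i).toReal * (harmonic i : ℝ))))) := by
  have hlim := h.ae_tendsto_ncard_cyclesIn hμ (· = (j : ℕ))
  have hmean : (∑' n : ℕ+, (p n).toReal * cycleMean (· = (j : ℕ)) n) =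
      (P {ω | j ≤ Y 0 ω}).toReal / (j : ℕ) := by
    rw [← toReal_tsum_cycleMean hμ, h.tsum_cycleMean_eq, ENNReal.toReal_div,
      ENNReal.toReal_natCast]
  rw [hmean] at hlim
  have htot := h.ae_tendsto_ncard_cyclesIn hμ (fun _ => True)
  have hsumm := summable_cycleMean hμ (fun _ => True)
  simp_rw [cycleMean_true] at htot hsumm
  refine ⟨h.toReal_measure_length_ge j, fun k => ?_, hlim, hsumm, ?_⟩
  · rw [← h.tsum_cycleMean_eq]
    simp_rw [cycleCount_eq]
    exact h.lintegral_ncard_cyclesIn (· = (j : ℕ)) k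
  · filter_upwards [hlim, htot] with ω h1 h2
    have hμ0 := h.meanLength_toReal_pos hμ
    have hH : 0 < ∑' i : ℕ+, (p i).toReal * (harmonic i : ℝ) := by
      obtain ⟨n, hn⟩ := p.support_nonempty
      refine hsumm.tsum_pos (fun i => ?_) n ?_
      · exact mul_nonneg ENNReal.toReal_nonneg
          (by rw [← cycleMean_true]; exact cycleMean_nonneg _ _)
      · exact mul_pos (ENNReal.toReal_pos hn (p.apply_ne_top n))
          (Rat.cast_pos.2 (harmonic_pos n.ne_zero))
    have h3 := h1.div h2 (div_pos hH hμ0).ne'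
    rw [← h.toReal_measure_length_ge, ← div_div, ← div_div_div_cancel_right₀ hμ0.ne']
    refine h3.congr' ?_
    filter_upwards [eventually_gt_atTop 0] with n hn
    have hn' : (n : ℝ) ≠ 0 := by exact_mod_cast hn.ne'
    simp only [Pi.div_apply]
    rw [div_div_div_cancel_right₀ hn', cycleCount_eq, totalCycleCount_eq]

end IsRecurrentRegenerative

/-! ### Displacements: the last renewal decomposition -/

/-- The value of `φ` at the displacement of the point with index `i` (counted from `0`) in a block, and `0` if the
block is too short to contain this point. -/
noncomputable def blockDisp (φ : ℤ → ℝ≥0∞) (i : ℕ) (b : BlockType) : ℝ≥0∞ :=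
  if hi : i < b.1 then φ (((b.2 ⟨i, hi⟩ : ℕ) : ℤ) - i) else 0

theorem displacement_of_reducedBlockIs {f : Equiv.Perm ℕ+} {m n : ℕ} {σ : Equiv.Perm (Fin n)}
    (h : ReducedBlockIs f m n σ) {i : ℕ} (hi : i < n) :
    displacement f (Nat.succPNat (m + i)) = ((σ ⟨i, hi⟩ : ℕ) : ℤ) - i := by
  have := h ⟨i, hi⟩
  simp only at this
  rw [displacement, this, Nat.succPNat_coe, Nat.succPNat_coe]
  push_cast
  ring

/-- The image of a point under a uniform permutation is uniform. -/
theorem sum_perm_apply {n : ℕ} (F : Fin n → ℝ≥0∞) (a : Fin n) :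
    n * ∑ σ : Equiv.Perm (Fin n), F (σ a) = n.factorial * ∑ b, F b := by
  have h1 : ∀ c : Fin n, ∑ σ : Equiv.Perm (Fin n), F (σ c) = ∑ σ : Equiv.Perm (Fin n), F (σ a) := by
    intro c
    rw [← Equiv.sum_comp (Equiv.mulRight (Equiv.swap a c)) fun σ : Equiv.Perm (Fin n) => F (σ c)]
    simp
  have h2 : ∑ c : Fin n, ∑ σ : Equiv.Perm (Fin n), F (σ c) = n.factorial * ∑ b, F b := by
    rw [Finset.sum_comm, Finset.sum_congr rfl fun σ _ => Equiv.sum_comp σ F, Finset.sum_const,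
      Finset.card_univ, Fintype.card_perm, Fintype.card_fin, nsmul_eq_mul]
  rw [← h2, Finset.sum_congr rfl fun c _ => h1 c, Finset.sum_const, Finset.card_univ,
    Fintype.card_fin, nsmul_eq_mul]

theorem sum_uniform_blockDisp (φ : ℤ → ℝ≥0∞) (n : ℕ+) :
    ∑ σ : Equiv.Perm (Fin n), uniformBlocks n σ * ∑' i, blockDisp φ i ⟨n, σ⟩ = blockMean φ n := by
  have hn : ((n : ℕ) : ℝ≥0∞) ≠ 0 := by exact_mod_cast n.ne_zero
  have hf : (((n : ℕ).factorial : ℕ) : ℝ≥0∞) ≠ 0 := by exact_mod_cast Nat.factorial_ne_zero _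
  have h1 : ∀ σ : Equiv.Perm (Fin n), ∑' i, blockDisp φ i ⟨n, σ⟩ =
      ∑ a : Fin n, φ (((σ a : ℕ) : ℤ) - a) := by
    intro σ
    rw [tsum_eq_sum (s := Finset.range n), Finset.sum_range]
    · refine Finset.sum_congr rfl fun a _ => ?_
      rw [blockDisp, dif_pos a.2]
    · intro i hi
      rw [blockDisp, dif_neg (by simpa using hi)]
  simp only [h1, uniformBlocks, PMF.uniformOfFintype_apply, Fintype.card_perm, Fintype.card_fin]
  rw [← Finset.mul_sum, Finset.sum_comm, blockMean, Finset.sum_range, Finset.mul_sum,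
    div_eq_mul_inv, Finset.sum_mul]
  refine Finset.sum_congr rfl fun a _ => ?_
  have h2 := sum_perm_apply (fun b : Fin n => φ (((b : ℕ) : ℤ) - a)) a
  rw [Finset.sum_range]
  calc (((n : ℕ).factorial : ℕ) : ℝ≥0∞)⁻¹ * ∑ σ : Equiv.Perm (Fin n), φ (((σ a : ℕ) : ℤ) - a)
      = (((n : ℕ).factorial : ℕ) : ℝ≥0∞)⁻¹ * (((n : ℕ) : ℝ≥0∞)⁻¹ *
          ((n : ℕ) * ∑ σ : Equiv.Perm (Fin n), φ (((σ a : ℕ) : ℤ) - a))) := by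
        rw [← mul_assoc ((n : ℕ) : ℝ≥0∞)⁻¹, ENNReal.inv_mul_cancel hn (ENNReal.natCast_ne_top _),
          one_mul]
    _ = ((((n : ℕ).factorial : ℕ) : ℝ≥0∞)⁻¹ * ((n : ℕ).factorial : ℕ)) *
          ((∑ b : Fin n, φ (((b : ℕ) : ℤ) - a)) * ((n : ℕ) : ℝ≥0∞)⁻¹) := by
        rw [h2]; ring
    _ = _ := by rw [ENNReal.inv_mul_cancel hf (ENNReal.natCast_ne_top _), one_mul]

theorem tendsto_pnat_atTop {α : Type*} {l : Filter α} {F : ℕ+ → α}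
    (h : Tendsto (fun N : ℕ => F (Nat.succPNat N)) atTop l) : Tendsto F atTop l := by
  have h1 : Tendsto PNat.natPred atTop atTop := tendsto_atTop.2 fun b => by
    filter_upwards [eventually_ge_atTop (Nat.succPNat b)] with n hn
    have h2 : b + 1 ≤ (n : ℕ) := by exact_mod_cast hn
    have h3 := PNat.natPred_add_one n
    omega
  refine (h.comp h1).congr fun n => ?_
  simp

namespace IsRecurrentRegenerative

variable {Ω : Type*} [MeasurableSpace Ω] {P : Measure Ω}
  {Per : Ω → Equiv.Perm ℕ+} {T₀ : Ω → ℕ} {Y : ℕ → Ω → ℕ+} {p : PMF ℕ+}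

section General

variable {Q : ∀ n : ℕ+, PMF (Equiv.Perm (Fin n))} (h : IsRecurrentRegenerative P Per T₀ Y p Q)
include h

theorem measurable_displacement (n : ℕ+) : Measurable fun ω => displacement (Per ω) n :=
  (Measurable.of_discrete (f := fun m : ℕ+ => ((m : ℕ) : ℤ) - (n : ℕ))).comp (h.measurable_Per n)

/-- The pointwise form of the decomposition by the last renewal: of all terms on the right, only the one for the block
containing `N + 1` and the index `i` of `N + 1` in this block can be nonzero. -/
theorem ae_displacement_eq_tsum (φ : ℤ → ℝ≥0∞) (N : ℕ) : ∀ᵐ ω ∂P,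
    (if T₀ ω ≤ N then φ (displacement (Per ω) (Nat.succPNat N)) else 0) =
      ∑ i ∈ Finset.range (N + 1), ∑' k,
        if renewalTime T₀ Y k ω = N - i then blockDisp φ i (block Per T₀ Y k ω) else 0 := by
  filter_upwards [h.ae_reducedBlockIs] with ω hω
  have hlt : ∀ i k, blockDisp φ i (block Per T₀ Y k ω) ≠ 0 → i < Y k ω := by
    intro i k hne
    by_contra hi
    exact hne (by rw [blockDisp, dif_neg]; exact hi)
  split_ifs with hT
  · obtain ⟨k, hk, huniq⟩ := existsUnique_block_mem (Y := Y) (Nat.lt_succ_of_le hT)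
    rw [renewalTime_succ] at hk
    rw [Finset.sum_eq_single_of_mem (N - renewalTime T₀ Y k ω)
      (Finset.mem_range.2 (by omega)), tsum_eq_single k]
    · have hi : N - renewalTime T₀ Y k ω < Y k ω := by omega
      have h1 := displacement_of_reducedBlockIs (hω k) hi
      rw [show renewalTime T₀ Y k ω + (N - renewalTime T₀ Y k ω) = N by omega] at h1
      rw [if_pos (by omega), blockDisp, dif_pos (show _ < ((block Per T₀ Y k ω).1 : ℕ) from hi)]
      exact congrArg φ h1
    · intro j hj
      by_contra hne
      rw [ite_eq_right_iff] at hne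
      push Not at hne
      have h1 := hlt _ _ hne.2
      exact hj (huniq j ⟨by omega, by rw [renewalTime_succ]; omega⟩)
    · intro i hi hik
      refine ENNReal.tsum_eq_zero.2 fun j => ?_
      by_contra hne
      rw [ite_eq_right_iff] at hne
      push Not at hne
      have h1 := hlt _ _ hne.2
      have h2 := Finset.mem_range.1 hi
      have h3 := huniq j ⟨by omega, by rw [renewalTime_succ]; omega⟩
      subst h3
      omega
  · symm
    refine Finset.sum_eq_zero fun i _ => ENNReal.tsum_eq_zero.2 fun k => if_neg ?_
    rw [renewalTime]
    omega

theorem measurable_renewal_blockDisp (φ : ℤ → ℝ≥0∞) (i k m : ℕ) :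
    Measurable fun ω => if renewalTime T₀ Y k ω = m then blockDisp φ i (block Per T₀ Y k ω)
      else 0 :=
  Measurable.ite (h.measurable_renewalTime k (measurableSet_singleton m))
    ((Measurable.of_discrete (f := blockDisp φ i)).comp (h.measurable_block k)) measurable_const

/-- Decomposition according to the last renewal before `N + 1`. -/
theorem lintegral_displacement_eq_sum [IsProbabilityMeasure P] (φ : ℤ → ℝ≥0∞) (N : ℕ) :
    ∫⁻ ω, (if T₀ ω ≤ N then φ (displacement (Per ω) (Nat.succPNat N)) else 0) ∂P =
      ∑ i ∈ Finset.range (N + 1), P {ω | RenewalAt T₀ Y (N - i) ω} *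
        ∫⁻ ω, blockDisp φ i (block Per T₀ Y 0 ω) ∂P := by
  classical
  rw [lintegral_congr_ae (h.ae_displacement_eq_tsum φ N), lintegral_finsetSum]
  · refine Finset.sum_congr rfl fun i _ => ?_
    rw [← h.tsum_lintegral_renewal, lintegral_tsum]
    exact fun k => (h.measurable_renewal_blockDisp φ i k _).aemeasurable
  · exact fun i _ => Measurable.tsum fun k => h.measurable_renewal_blockDisp φ i k _

theorem lintegral_blockDisp_one (i k : ℕ) :
    ∫⁻ ω, blockDisp (fun _ => 1) i (block Per T₀ Y k ω) ∂P = P {ω | i < (Y k ω : ℕ)} := by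
  refine (lintegral_congr fun ω => ?_).trans (lintegral_indicator_one
    (h.measurable_length k (MeasurableSet.of_discrete (s := Set.Ioi i))))
  by_cases hi : i < (Y k ω : ℕ) <;> simp [Set.indicator, blockDisp, block, hi]

end General

variable (h : IsRecurrentRegenerative P Per T₀ Y p uniformBlocks)
include h

/-- Sum over all positions in a block of the mean of `φ` at the displacement at this position. -/
theorem tsum_lintegral_blockDisp [IsProbabilityMeasure P] (φ : ℤ → ℝ≥0∞) :
    ∑' i, ∫⁻ ω, blockDisp φ i (block Per T₀ Y 0 ω) ∂P = ∫⁻ ω, blockMean φ (Y 0 ω) ∂P := by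
  rw [← lintegral_tsum (f := fun i ω => blockDisp φ i (block Per T₀ Y 0 ω)) fun i =>
    ((Measurable.of_discrete (f := blockDisp φ i)).comp (h.measurable_block 0)).aemeasurable]
  rw [h.lintegral_block (fun b => ∑' i, blockDisp φ i b), h.lintegral_length fun n => blockMean φ n]
  exact tsum_congr fun n => by rw [sum_uniform_blockDisp]

theorem tsum_measure_length_gt [IsProbabilityMeasure P] :
    ∑' i : ℕ, P {ω | i < (Y 0 ω : ℕ)} = meanLength p := by
  rw [h.meanLength_eq_lintegral 0, ← lintegral_congr fun ω => blockMean_one (Y 0 ω),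
    ← h.tsum_lintegral_blockDisp]
  exact tsum_congr fun i => (h.lintegral_blockDisp_one i 0).symm

/-- The renewal theorem for the probabilities of a renewal at `n`. -/
theorem tendsto_measure_renewalAt [IsProbabilityMeasure P] (hμ : meanLength p ≠ ⊤)
    (hap : Aperiodic p) :
    Tendsto (fun n => P {ω | RenewalAt T₀ Y n ω}) atTop (𝓝 (meanLength p)⁻¹) := by
  set r : ℕ → ℝ := fun i => (P {ω | i < (Y 0 ω : ℕ)}).toReal
  set u : ℕ → ℝ := fun n => (P {ω | RenewalAt T₀ Y n ω}).toReal
  have htsum := h.tsum_measure_length_gt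
  have hr0 : r 0 = 1 := by
    simp [r]
  have hanti : Antitone r := fun i j hij =>
    ENNReal.toReal_mono (measure_ne_top _ _) (measure_mono fun ω hω => hij.trans_lt hω)
  have hsum : Summable r := ENNReal.summable_toReal (by rw [htsum]; exact hμ)
  have hrμ : ∑' i, r i = (meanLength p).toReal := by
    rw [← htsum, ENNReal.tsum_toReal_eq fun i => measure_ne_top _ _]
  have hu : ∀ n, u n ∈ Set.Icc (0 : ℝ) 1 := fun n =>
    ⟨ENNReal.toReal_nonneg, ENNReal.toReal_le_of_le_ofReal zero_le_one (by simpa using prob_le_one)⟩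
  have hid : Tendsto (fun n => ∑ i ∈ Finset.range (n + 1), r i * u (n - i)) atTop (𝓝 1) := by
    -- The decomposition by the last renewal for `φ = 1`.
    have h1 : ∀ n, P {ω | T₀ ω ≤ n} = ∑ i ∈ Finset.range (n + 1),
        P {ω | RenewalAt T₀ Y (n - i) ω} * P {ω | i < (Y 0 ω : ℕ)} := by
      intro n
      have h2 := h.lintegral_displacement_eq_sum (fun _ => 1) n
      simp_rw [h.lintegral_blockDisp_one] at h2
      rw [← h2]
      symm
      refine (lintegral_congr fun ω => ?_).trans (lintegral_indicator_one
        (h.measurable_delay (MeasurableSet.of_discrete (s := Set.Iic n))))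
      simp [Set.indicator]
    have h3 : Tendsto (fun n => P {ω | T₀ ω ≤ n}) atTop (𝓝 (P (⋃ n, {ω | T₀ ω ≤ n}))) :=
      tendsto_measure_iUnion_atTop fun a b hab ω (hω : T₀ ω ≤ a) => hω.trans hab
    have h4 : ⋃ n, {ω | T₀ ω ≤ n} = Set.univ :=
      Set.eq_univ_of_forall fun ω => Set.mem_iUnion.2 ⟨T₀ ω, le_refl (T₀ ω)⟩
    rw [h4, measure_univ] at h3
    have h5 := (ENNReal.tendsto_toReal ENNReal.one_ne_top).comp h3
    rw [ENNReal.toReal_one] at h5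
    refine h5.congr fun n => ?_
    simp only [Function.comp]
    rw [h1, ENNReal.toReal_sum fun i _ => ENNReal.mul_ne_top (measure_ne_top _ _)
      (measure_ne_top _ _)]
    refine Finset.sum_congr rfl fun i _ => ?_
    rw [ENNReal.toReal_mul, mul_comm]
  -- The step lengths are the `i + 1` with `r i - r (i + 1) = p (i + 1) ≠ 0`.
  have hap' : ∀ d : ℕ, (∀ i, r i ≠ r (i + 1) → d ∣ i + 1) → d = 1 := by
    refine fun d hd => hap d fun n hn => ?_
    have hni : n.natPred + 1 = (n : ℕ) := PNat.natPred_add_one n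
    rw [← hni]
    refine hd _ fun heq => ?_
    have hsplit : P {ω | n.natPred < (Y 0 ω : ℕ)} =
        P {ω | Y 0 ω = n} + P {ω | n.natPred + 1 < (Y 0 ω : ℕ)} := by
      rw [← measure_union]
      · congr 1
        ext ω
        simp only [Set.mem_ofPred_eq, Set.mem_union]
        rw [← PNat.coe_inj]
        omega
      · refine Set.disjoint_left.2 fun ω (h1 : Y 0 ω = n)
          (h2 : n.natPred + 1 < (Y 0 ω : ℕ)) => ?_
        rw [h1] at h2
        omega
      · exact h.measurable_length 0 (MeasurableSet.of_discrete (s := Set.Ioi (n.natPred + 1)))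
    simp only [r] at heq
    rw [hsplit, ENNReal.toReal_add (measure_ne_top _ _) (measure_ne_top _ _), h.law_length] at heq
    have : 0 < (p n).toReal := ENNReal.toReal_pos hn (p.apply_ne_top n)
    linarith
  have hlim := renewal_limit hr0 hanti (fun i => ENNReal.toReal_nonneg) hsum hu hid hap'
  have hμ0 := h.meanLength_toReal_pos hμ
  rw [hrμ] at hlim
  have h6 := ENNReal.tendsto_ofReal hlim
  rw [ENNReal.ofReal_inv_of_pos hμ0, ENNReal.ofReal_toReal hμ] at h6
  exact h6.congr fun n => ENNReal.ofReal_toReal (measure_ne_top _ _)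

/-- Convergence of means of functions of the displacement. On the delay block nothing is known about the
permutation except that it maps this block to itself, whence the domination by a function of the delay. -/
theorem tendsto_lintegral_displacement [IsProbabilityMeasure P] (hμ : meanLength p ≠ ⊤)
    (hap : Aperiodic p) (φ : ℤ → ℝ≥0∞) (H : ℕ → ℝ≥0∞) (hH : ∫⁻ ω, H (T₀ ω) ∂P ≠ ⊤)
    (hφ : ∀ (t : ℕ) (d : ℤ), |d| ≤ t → φ d ≤ H t) :
    Tendsto (fun n : ℕ+ => ∫⁻ ω, φ (displacement (Per ω) n) ∂P) atTop
      (𝓝 ((meanLength p)⁻¹ * ∫⁻ ω, blockMean φ (Y 0 ω) ∂P)) := by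
  refine tendsto_pnat_atTop ?_
  have hmain : Tendsto (fun N : ℕ => ∫⁻ ω, (if T₀ ω ≤ N then
      φ (displacement (Per ω) (Nat.succPNat N)) else 0) ∂P) atTop
      (𝓝 ((meanLength p)⁻¹ * ∫⁻ ω, blockMean φ (Y 0 ω) ∂P)) := by
    have h1 := tendsto_convolution (h.tendsto_measure_renewalAt hμ hap) (fun n => prob_le_one)
      (ENNReal.inv_ne_zero.2 hμ) (g := fun i => ∫⁻ ω, blockDisp φ i (block Per T₀ Y 0 ω) ∂P)
    rw [h.tsum_lintegral_blockDisp] at h1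
    refine (h1.comp (tendsto_add_atTop_nat 1)).congr fun N => ?_
    rw [h.lintegral_displacement_eq_sum]
    simp
  have hrest : Tendsto (fun N : ℕ => ∫⁻ ω, (if T₀ ω ≤ N then 0 else H (T₀ ω)) ∂P) atTop (𝓝 0) := by
    have h1 := tendsto_lintegral_of_dominated_convergence (μ := P)
      (F := fun N ω => if T₀ ω ≤ N then 0 else H (T₀ ω)) (f := fun _ => 0) (fun ω => H (T₀ ω))
      (fun N => (Measurable.of_discrete (f := fun t : ℕ => if t ≤ N then 0 else H t)).comp
        h.measurable_delay)
      (fun N => Eventually.of_forall fun ω => by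
        dsimp only
        split_ifs
        · exact zero_le
        · exact le_rfl) hH
      (Eventually.of_forall fun ω => tendsto_const_nhds.congr' (by
        filter_upwards [eventually_ge_atTop (T₀ ω)] with N hN
        rw [if_pos hN]))
    rwa [lintegral_zero] at h1
  have hupper := hmain.add hrest
  rw [add_zero] at hupper
  refine tendsto_of_tendsto_of_tendsto_of_le_of_le hmain hupper (fun N => ?_) fun N => ?_
  · refine lintegral_mono fun ω => ?_
    dsimp only
    split_ifs
    · exact le_rfl
    · exact zero_le
  · dsimp only
    rw [← lintegral_add_right (g := fun ω => if T₀ ω ≤ N then 0 else H (T₀ ω)) _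
      ((Measurable.of_discrete (f := fun t : ℕ => if t ≤ N then 0 else H t)).comp
        h.measurable_delay)]
    refine lintegral_mono_ae ?_
    filter_upwards [h.splits] with ω hω
    split_ifs with hT
    · rw [add_zero]
    · rw [zero_add]
      refine hφ _ _ ?_
      have h1 := (hω 0 (Nat.succPNat N)).2
      rw [renewalTime_zero, Nat.succPNat_coe] at h1
      have h2 := h1 (by omega)
      have h3 := (Per ω (Nat.succPNat N)).pos
      rw [displacement, Nat.succPNat_coe, abs_le]
      constructor <;> push_cast <;> omega

end IsRecurrentRegenerative

/-! ### The stationary version -/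

namespace IsStationaryVersion

open Classical in
/-- The displacement of the point at distance `i + 1` after a renewal, as a function of the path after
this renewal, on the event that there is no renewal strictly in between. -/
noncomputable def pathDisp (φ : ℤ → ℝ≥0∞) (i : ℕ) (x : ℕ+ → ℤ × Prop) : ℝ≥0∞ :=
  if ∀ j : ℕ+, (j : ℕ) ≤ i → ¬ (x j).2 then φ ((x (Nat.succPNat i)).1 - (i + 1)) else 0

theorem measurable_pathDisp (φ : ℤ → ℝ≥0∞) (i : ℕ) : Measurable (pathDisp φ i) := by
  refine Measurable.ite ?_ ?_ measurable_const
  · have : {x : ℕ+ → ℤ × Prop | ∀ j : ℕ+, (j : ℕ) ≤ i → ¬ (x j).2} =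
        ⋂ j : ℕ+, ⋂ _ : (j : ℕ) ≤ i, (fun x : ℕ+ → ℤ × Prop => x j) ⁻¹' {y | ¬ y.2} := by
      ext x; simp
    rw [this]
    exact MeasurableSet.iInter fun j => MeasurableSet.iInter fun _ =>
      measurable_pi_apply j MeasurableSet.of_discrete
  · exact (Measurable.of_discrete (f := fun y : ℤ × Prop => φ (y.1 - (i + 1)))).comp
      (measurable_pi_apply _)

/-- The event that the last renewal before `z` is at `z - 1 - i`. -/
def lastRenewal {Ω' : Type*} (Ren : Ω' → Set ℤ) (z : ℤ) (i : ℕ) : Set Ω' :=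
  {ω | z - 1 - i ∈ Ren ω ∧ ∀ j : ℕ+, (j : ℕ) ≤ i → z - 1 - i + (j : ℕ) ∉ Ren ω}

theorem disjoint_lastRenewal {Ω' : Type*} {Ren : Ω' → Set ℤ} (z : ℤ) :
    Pairwise (Function.onFun Disjoint (lastRenewal Ren z)) := by
  have key : ∀ i j, i < j → Disjoint (lastRenewal Ren z i) (lastRenewal Ren z j) := by
    intro i j hij
    refine Set.disjoint_left.2 fun ω hi hj => ?_
    have h1 := hj.2 ⟨j - i, by omega⟩ (by simp)
    refine h1 ?_
    have h2 : z - 1 - (j : ℤ) + ((j - i : ℕ) : ℤ) = z - 1 - i := by omega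
    rw [PNat.mk_coe, h2]
    exact hi.1
  intro i j hij
  rcases lt_or_gt_of_ne hij with h1 | h1
  · exact key i j h1
  · exact (key j i h1).symm

variable {Ω Ω' : Type*} [MeasurableSpace Ω] [MeasurableSpace Ω'] {P : Measure Ω}
  {Per : Ω → Equiv.Perm ℕ+} {T₀ : Ω → ℕ} {Y : ℕ → Ω → ℕ+} {p : PMF ℕ+}
  {P' : Measure Ω'} {StarPer : Ω' → Equiv.Perm ℤ} {Ren : Ω' → Set ℤ}

open Classical in
/-- For the one-sided process, having no renewal at distance at most `i` after a renewal means that the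
block which starts there is longer than `i`. -/
theorem ae_pathDisp_eq_tsum {Q : ∀ n : ℕ+, PMF (Equiv.Perm (Fin n))}
    (h : IsRecurrentRegenerative P Per T₀ Y p Q) (φ : ℤ → ℝ≥0∞) (i n : ℕ) : ∀ᵐ ω ∂P,
    (if RenewalAt T₀ Y n ω then pathDisp φ i (fun i : ℕ+ =>
        (((Per ω (Nat.succPNat (n + i.natPred)) : ℕ) : ℤ) - (n : ℤ),
          RenewalAt T₀ Y (n + (i : ℕ)) ω)) else 0) =
      ∑' k, if renewalTime T₀ Y k ω = n then blockDisp φ i (block Per T₀ Y k ω) else 0 := by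
  filter_upwards [h.ae_reducedBlockIs] with ω hω
  have hmono := renewalTime_strictMono (T₀ := T₀) (Y := Y) ω
  split_ifs with hR
  · obtain ⟨k, rfl⟩ := hR
    rw [tsum_eq_single k fun j hj => if_neg fun hjk => hj (hmono.injective hjk), if_pos rfl,
      pathDisp]
    have hiff : (∀ j : ℕ+, (j : ℕ) ≤ i →
        ¬ RenewalAt T₀ Y (renewalTime T₀ Y k ω + (j : ℕ)) ω) ↔ i < (Y k ω : ℕ) := by
      constructor
      · intro hno
        by_contra! hle
        exact hno (Y k ω) hle ⟨k + 1, renewalTime_succ k ω⟩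
      · rintro hi j hj ⟨m, hm⟩
        have h1 : k < m := hmono.lt_iff_lt.1 (by simp only [hm]; have := j.pos; omega)
        have h2 : m < k + 1 := hmono.lt_iff_lt.1 (by
          simp only [hm, renewalTime_succ]; omega)
        omega
    by_cases hi : i < (Y k ω : ℕ)
    · rw [if_pos (hiff.2 hi), blockDisp, dif_pos (show i < ((block Per T₀ Y k ω).1 : ℕ) from hi)]
      have h1 := displacement_of_reducedBlockIs (hω k) hi
      rw [displacement, Nat.succPNat_coe] at h1
      simp only [Nat.natPred_succPNat]
      refine congrArg φ (Eq.trans ?_ h1)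
      push_cast
      ring
    · rw [if_neg (fun hc => hi (hiff.1 hc)), blockDisp,
        dif_neg (show ¬ i < ((block Per T₀ Y k ω).1 : ℕ) from hi)]
  · symm
    exact ENNReal.tsum_eq_zero.2 fun k => if_neg fun hk => hR ⟨k, hk⟩

variable (hS : IsStationaryVersion P Per T₀ Y p P' StarPer Ren)
include hS

theorem measurableSet_lastRenewal (z : ℤ) (i : ℕ) : MeasurableSet (lastRenewal Ren z i) := by
  have : lastRenewal Ren z i = {ω | z - 1 - i ∈ Ren ω} ∩
      ⋂ j : ℕ+, ⋂ _ : (j : ℕ) ≤ i, {ω | z - 1 - i + (j : ℕ) ∈ Ren ω}ᶜ := by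
    ext ω; simp [lastRenewal]
  rw [this]
  exact (hS.measurable_renewal _).inter (MeasurableSet.iInter fun j => MeasurableSet.iInter
    fun _ => (hS.measurable_renewal _).compl)

variable [IsProbabilityMeasure P]
  (h : IsRecurrentRegenerative P Per T₀ Y p uniformBlocks) (hμ : meanLength p ≠ ⊤)
include h hμ

/-- By the regenerative property, the path after a renewal at `z - 1 - i`, which has probability `1 / μ`, is
distributed as the path of the one-sided process after a renewal at some `n`, which starts with a block
distributed as the first one. -/
theorem setLIntegral_lastRenewal (φ : ℤ → ℝ≥0∞) (z : ℤ) (i : ℕ) :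
    ∫⁻ ω in lastRenewal Ren z i, φ (StarPer ω z - z) ∂P' =
      (meanLength p)⁻¹ * ∫⁻ ω, blockDisp φ i (block Per T₀ Y 0 ω) ∂P := by
  classical
  obtain ⟨n, hn⟩ : ∃ n, P {ω | RenewalAt T₀ Y n ω} ≠ 0 := by
    by_contra! hc
    have h1 : P (⋃ n, {ω | RenewalAt T₀ Y n ω}) = 0 := measure_iUnion_null hc
    have h2 : ⋃ n, {ω | RenewalAt T₀ Y n ω} = Set.univ :=
      Set.eq_univ_of_forall fun ω => Set.mem_iUnion.2 ⟨T₀ ω, 0, renewalTime_zero ω⟩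
    rw [h2, measure_univ] at h1
    exact one_ne_zero h1
  set y : ℤ := z - 1 - i
  have hmy : MeasurableSet {ω | y ∈ Ren ω} := hS.measurable_renewal y
  have hmn : MeasurableSet {ω | RenewalAt T₀ Y n ω} := h.measurableSet_renewalAt n
  have hreg := congrArg (fun ν => ∫⁻ x, pathDisp φ i x ∂ν) (hS.regenerative y n hn)
  have hm1 : Measurable fun ω (i : ℕ+) =>
      (StarPer ω (y + ((i : ℕ) : ℤ)) - y, y + ((i : ℕ) : ℤ) ∈ Ren ω) :=
    measurable_pi_lambda _ fun i => Measurable.prodMk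
      ((Measurable.of_discrete (f := fun m : ℤ => m - y)).comp (hS.measurable_perm _))
      (measurableSet_setOfPred.1 (hS.measurable_renewal _))
  have hm2 : Measurable fun ω (i : ℕ+) =>
      (((Per ω (Nat.succPNat (n + i.natPred)) : ℕ) : ℤ) - (n : ℤ),
          RenewalAt T₀ Y (n + (i : ℕ)) ω) :=
    measurable_pi_lambda _ fun i => Measurable.prodMk
      ((Measurable.of_discrete (f := fun m : ℕ => (m : ℤ) - n)).comp (h.measurable_perm _))
      (measurableSet_setOfPred.1 (h.measurableSet_renewalAt _))
  rw [lintegral_map (measurable_pathDisp φ i) hm1, lintegral_map (measurable_pathDisp φ i) hm2,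
    ProbabilityTheory.cond, ProbabilityTheory.cond, lintegral_smul_measure, lintegral_smul_measure,
    hS.renewal_prob, inv_inv, smul_eq_mul, smul_eq_mul] at hreg
  have hright : ∫⁻ ω in {ω | RenewalAt T₀ Y n ω}, pathDisp φ i (fun i : ℕ+ =>
        (((Per ω (Nat.succPNat (n + i.natPred)) : ℕ) : ℤ) - (n : ℤ),
          RenewalAt T₀ Y (n + (i : ℕ)) ω)) ∂P =
      P {ω | RenewalAt T₀ Y n ω} * ∫⁻ ω, blockDisp φ i (block Per T₀ Y 0 ω) ∂P := by
    rw [← h.tsum_lintegral_renewal, ← lintegral_tsum fun k =>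
      (h.measurable_renewal_blockDisp φ i k n).aemeasurable, ← lintegral_indicator hmn]
    refine lintegral_congr_ae ?_
    filter_upwards [ae_pathDisp_eq_tsum h φ i n] with ω hω
    rw [← hω]
    rfl
  have hleft : ∫⁻ ω in {ω | y ∈ Ren ω}, pathDisp φ i (fun i : ℕ+ =>
      (StarPer ω (y + ((i : ℕ) : ℤ)) - y, y + ((i : ℕ) : ℤ) ∈ Ren ω)) ∂P' =
      ∫⁻ ω in lastRenewal Ren z i, φ (StarPer ω z - z) ∂P' := by
    rw [← lintegral_indicator hmy, ← lintegral_indicator (hS.measurableSet_lastRenewal z i)]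
    refine lintegral_congr fun ω => ?_
    have hz : y + ((Nat.succPNat i : ℕ) : ℤ) = z := by
      rw [Nat.succPNat_coe]; simp only [y]; push_cast; ring
    by_cases h1 : y ∈ Ren ω
    · rw [Set.indicator_of_mem (show ω ∈ {ω | y ∈ Ren ω} from h1), pathDisp]
      by_cases h2 : ∀ j : ℕ+, (j : ℕ) ≤ i → y + (j : ℕ) ∉ Ren ω
      · rw [if_pos h2, Set.indicator_of_mem (show ω ∈ lastRenewal Ren z i from ⟨h1, h2⟩)]
        simp only [hz]
        congr 1
        simp only [y]; ring
      · rw [if_neg h2, Set.indicator_of_notMem fun hc => h2 hc.2]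
    · rw [Set.indicator_of_notMem (show ω ∉ {ω | y ∈ Ren ω} from h1),
        Set.indicator_of_notMem fun hc => h1 hc.1]
  rw [hleft, hright, ← mul_assoc, ENNReal.inv_mul_cancel hn (measure_ne_top _ _), one_mul] at hreg
  have hμ0 : meanLength p ≠ 0 := fun h0 => by
    have := h.meanLength_toReal_pos hμ
    rw [h0] at this
    exact lt_irrefl _ this
  rw [← hreg, ← mul_assoc, ENNReal.inv_mul_cancel hμ0 hμ, one_mul]

end IsStationaryVersion

/-- In the stationary version a point almost surely has a renewal before it, since the probabilities of the
possible positions of the last such renewal sum to one. -/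
theorem IsStationaryVersion.lintegral_displacement {Ω Ω' : Type*} [MeasurableSpace Ω]
    [MeasurableSpace Ω'] {P : Measure Ω} [IsProbabilityMeasure P]
    {Per : Ω → Equiv.Perm ℕ+} {T₀ : Ω → ℕ} {Y : ℕ → Ω → ℕ+} {p : PMF ℕ+}
    {P' : Measure Ω'} [IsProbabilityMeasure P'] {StarPer : Ω' → Equiv.Perm ℤ} {Ren : Ω' → Set ℤ}
    (hS : IsStationaryVersion P Per T₀ Y p P' StarPer Ren)
    (h : IsRecurrentRegenerative P Per T₀ Y p uniformBlocks) (hμ : meanLength p ≠ ⊤)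
    (φ : ℤ → ℝ≥0∞) (z : ℤ) :
    ∫⁻ ω, φ (StarPer ω z - z) ∂P' = (meanLength p)⁻¹ * ∫⁻ ω, blockMean φ (Y 0 ω) ∂P := by
  have hsum : ∀ φ : ℤ → ℝ≥0∞, ∫⁻ ω in ⋃ i, lastRenewal Ren z i, φ (StarPer ω z - z) ∂P' =
      (meanLength p)⁻¹ * ∫⁻ ω, blockMean φ (Y 0 ω) ∂P := by
    intro φ
    rw [lintegral_iUnion (hS.measurableSet_lastRenewal z) (disjoint_lastRenewal z),
      ← h.tsum_lintegral_blockDisp, ← ENNReal.tsum_mul_left]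
    exact tsum_congr fun i => hS.setLIntegral_lastRenewal h hμ φ z i
  have hμ0 : meanLength p ≠ 0 := fun h0 => by
    have := h.meanLength_toReal_pos hμ
    rw [h0] at this
    exact lt_irrefl _ this
  -- The case `φ = 1`.
  have hfull : P' (⋃ i, lastRenewal Ren z i) = 1 := by
    have h1 := hsum fun _ => 1
    simp_rw [blockMean_one] at h1
    rw [← h.meanLength_eq_lintegral 0, ENNReal.inv_mul_cancel hμ0 hμ, setLIntegral_one] at h1
    exact h1
  rw [← hsum φ]
  have hae : ∀ᵐ ω ∂P', ω ∈ ⋃ i, lastRenewal Ren z i :=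
    (mem_ae_iff_prob_eq_one (MeasurableSet.iUnion (hS.measurableSet_lastRenewal z))).2 hfull
  rw [Measure.restrict_eq_self_of_ae_mem hae]

/-! ### Evaluation of the limits -/

theorem lintegral_ite_eq_measure {α : Type*} [MeasurableSpace α] {ν : Measure α} {D : α → ℤ}
    (hD : Measurable D) (q : ℤ → Prop) [DecidablePred q] :
    ∫⁻ a, (if q (D a) then 1 else 0) ∂ν = ν {a | q (D a)} := by
  refine (lintegral_congr fun a => ?_).trans (lintegral_indicator_one
    (hD (MeasurableSet.of_discrete (s := {d | q d}))))
  simp [Set.indicator]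

/-- The limit of `E φ(D_n)`, which is also the value of `E φ(D*_z)`. -/
noncomputable def limitMean {Ω : Type*} [MeasurableSpace Ω] (P : Measure Ω) (Y : ℕ → Ω → ℕ+)
    (p : PMF ℕ+) (φ : ℤ → ℝ≥0∞) : ℝ≥0∞ :=
  (meanLength p)⁻¹ * ∫⁻ ω, blockMean φ (Y 0 ω) ∂P

theorem limitMean_neg_single {Ω : Type*} [MeasurableSpace Ω] (P : Measure Ω) (Y : ℕ → Ω → ℕ+)
    (p : PMF ℕ+) (d : ℤ) : limitMean P Y p (fun x => if x = -d then 1 else 0) =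
      limitMean P Y p (fun x => if x = d then 1 else 0) := by
  simp_rw [limitMean, blockMean_single]
  simp

namespace IsRecurrentRegenerative

variable {Ω : Type*} [MeasurableSpace Ω] {P : Measure Ω}
  {Per : Ω → Equiv.Perm ℕ+} {T₀ : Ω → ℕ} {Y : ℕ → Ω → ℕ+} {p : PMF ℕ+}
  (h : IsRecurrentRegenerative P Per T₀ Y p uniformBlocks)
include h

theorem toReal_limitMean_single (d : ℤ) :
    (limitMean P Y p (fun x => if x = d then 1 else 0)).toReal = 1 / (meanLength p).toReal *
      ∫ ω, max ((Y 0 ω : ℝ) - |(d : ℝ)|) 0 / (Y 0 ω : ℝ) ∂P := by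
  simp_rw [limitMean, blockMean_single]
  rw [ENNReal.toReal_mul, ENNReal.toReal_inv, one_div, integral_eq_lintegral_of_nonneg_ae]
  · exact Eventually.of_forall fun ω => div_nonneg (le_max_right _ _) (Nat.cast_nonneg _)
  · exact ((Measurable.of_discrete (f := fun n : ℕ => max ((n : ℝ) - |(d : ℝ)|) 0 / (n : ℝ))).comp
      (h.measurable_length 0)).aestronglyMeasurable

theorem limitMean_abs_rpow {r : ℝ} (hr : 0 < r) :
    limitMean P Y p (fun x => ENNReal.ofReal (|(x : ℝ)| ^ r)) =
      2 / meanLength p * ∫⁻ ω, ENNReal.ofReal (deltaFun r (Y 0 ω)) ∂P := by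
  simp_rw [limitMean, blockMean_abs_rpow hr]
  rw [lintegral_const_mul (f := fun ω => ENNReal.ofReal (deltaFun r (Y 0 ω))) _
    ((Measurable.of_discrete (f := fun n : ℕ+ => ENNReal.ofReal (deltaFun r n))).comp
      (h.measurable_Y 0)), ENNReal.div_eq_inv_mul, mul_assoc]

variable [IsProbabilityMeasure P] (hμ : meanLength p ≠ ⊤)
include hμ

theorem meanLength_ne_zero : meanLength p ≠ 0 := fun h0 => by
  have := h.meanLength_toReal_pos hμ
  rw [h0] at this
  exact lt_irrefl _ this

theorem limitMean_one : limitMean P Y p (fun _ => 1) = 1 := by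
  simp_rw [limitMean, blockMean_one]
  rw [← h.meanLength_eq_lintegral 0, ENNReal.inv_mul_cancel (h.meanLength_ne_zero hμ) hμ]

theorem tsum_limitMean_single :
    ∑' d : ℤ, limitMean P Y p (fun x => if x = d then 1 else 0) = 1 := by
  refine Eq.trans ?_ (h.limitMean_one hμ)
  simp_rw [limitMean]
  rw [ENNReal.tsum_mul_left, ← lintegral_tsum (f := fun d ω =>
    blockMean (fun x => if x = d then 1 else 0) (Y 0 ω)) fun d => ((Measurable.of_discrete
    (f := fun n : ℕ => blockMean (fun x => if x = d then 1 else 0) n)).comp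
      (h.measurable_length 0)).aemeasurable]
  congr 1
  refine lintegral_congr fun ω => ?_
  simp_rw [blockMean, div_eq_mul_inv]
  rw [ENNReal.tsum_mul_right, Summable.tsum_finsetSum fun _ _ => ENNReal.summable]
  congr 1
  refine Finset.sum_congr rfl fun a _ => ?_
  rw [Summable.tsum_finsetSum fun _ _ => ENNReal.summable]
  exact Finset.sum_congr rfl fun b _ =>
    (tsum_congr fun d => if_congr eq_comm rfl rfl).trans (tsum_ite_eq ((b : ℤ) - a) fun _ => 1)

theorem hasSum_limit : HasSum (fun d : ℤ => 1 / (meanLength p).toReal *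
    ∫ ω, max ((Y 0 ω : ℝ) - |(d : ℝ)|) 0 / (Y 0 ω : ℝ) ∂P) 1 := by
  simp_rw [← h.toReal_limitMean_single]
  have h1 := h.tsum_limitMean_single hμ
  have hne : ∑' d : ℤ, limitMean P Y p (fun x => if x = d then 1 else 0) ≠ ⊤ := by
    rw [h1]; exact ENNReal.one_ne_top
  have h2 := ENNReal.hasSum_toReal hne
  rwa [← ENNReal.tsum_toReal_eq fun d => ENNReal.ne_top_of_tsum_ne_top hne d, h1,
    ENNReal.toReal_one] at h2

/-- The mean of `(Y - 1) / 2`, from `Y = 2 * ((Y - 1) / 2) + 1`. -/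
theorem lintegral_half_length : (∫⁻ ω, ENNReal.ofReal (((Y 0 ω : ℝ) - 1) / 2) ∂P).toReal =
    ((meanLength p).toReal - 1) / 2 := by
  have h1 : meanLength p = 2 * ∫⁻ ω, ENNReal.ofReal (((Y 0 ω : ℝ) - 1) / 2) ∂P + 1 := by
    have hm : Measurable fun ω => ENNReal.ofReal (((Y 0 ω : ℝ) - 1) / 2) :=
      (Measurable.of_discrete (f := fun n : ℕ => ENNReal.ofReal (((n : ℝ) - 1) / 2))).comp
        (h.measurable_length 0)
    rw [h.meanLength_eq_lintegral 0, ← lintegral_const_mul _ hm]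
    have hone : ∫⁻ _, (1 : ℝ≥0∞) ∂P = 1 := by simp
    conv_rhs => rw [← hone]
    rw [← lintegral_add_right _ measurable_const]
    refine lintegral_congr fun ω => ?_
    have h2 : (1 : ℝ) ≤ (Y 0 ω : ℕ) := by exact_mod_cast (Y 0 ω).pos
    rw [show (2 : ℝ≥0∞) = ENNReal.ofReal 2 by simp, ← ENNReal.ofReal_mul (by norm_num),
      ← ENNReal.ofReal_one, ← ENNReal.ofReal_add (by linarith) zero_le_one,
      ← ENNReal.ofReal_natCast]
    congr 1
    ring
  have h3 : ∫⁻ ω, ENNReal.ofReal (((Y 0 ω : ℝ) - 1) / 2) ∂P ≠ ⊤ := fun ht => by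
    rw [ht] at h1
    exact hμ (by rw [h1]; simp)
  rw [h1, ENNReal.toReal_add (ENNReal.mul_ne_top (by simp) h3) (by simp), ENNReal.toReal_mul]
  simp

theorem toReal_limitMean_pos : (limitMean P Y p (fun x => if 0 < x then 1 else 0)).toReal =
    1 / 2 * (1 - 1 / (meanLength p).toReal) := by
  simp_rw [limitMean, blockMean_pos]
  have h1 := (h.meanLength_toReal_pos hμ).ne'
  rw [ENNReal.toReal_mul, ENNReal.toReal_inv, h.lintegral_half_length hμ]
  field_simp

theorem toReal_limitMean_neg : (limitMean P Y p (fun x => if x < 0 then 1 else 0)).toReal =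
    1 / 2 * (1 - 1 / (meanLength p).toReal) := by
  rw [← h.toReal_limitMean_pos hμ]
  simp_rw [limitMean, blockMean_pos, blockMean_neg]

/-- The limit is finite exactly when `Y` has a finite moment of order `r + 1`, as `δ_r(n)` is of the
order of `n ^ (r + 1)`. -/
theorem limitMean_lt_top_iff {r : ℝ} (hr : 0 < r) :
    2 / meanLength p * ∫⁻ ω, ENNReal.ofReal (deltaFun r (Y 0 ω)) ∂P < ⊤ ↔
      ∫⁻ ω, ENNReal.ofReal ((Y 0 ω : ℝ) ^ (r + 1)) ∂P < ⊤ := by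
  have hμ0 := h.meanLength_ne_zero hμ
  have hδ : Measurable fun ω => ENNReal.ofReal (deltaFun r (Y 0 ω)) :=
    (Measurable.of_discrete (f := fun n : ℕ+ => ENNReal.ofReal (deltaFun r n))).comp
      (h.measurable_Y 0)
  have hI : 2 / meanLength p * ∫⁻ ω, ENNReal.ofReal (deltaFun r (Y 0 ω)) ∂P < ⊤ ↔
      ∫⁻ ω, ENNReal.ofReal (deltaFun r (Y 0 ω)) ∂P < ⊤ := by
    constructor
    · intro hlt
      by_contra! hc
      rw [top_le_iff.1 hc, ENNReal.mul_top (ENNReal.div_ne_zero.2 ⟨two_ne_zero, hμ⟩)] at hlt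
      exact lt_irrefl _ hlt
    · exact fun hlt => ENNReal.mul_lt_top (ENNReal.div_lt_top (by simp) hμ0) hlt
  rw [hI]
  constructor
  · intro hlt
    have h1 : ∫⁻ ω, ENNReal.ofReal ((Y 0 ω : ℝ) ^ (r + 1)) ∂P ≤ ∫⁻ ω, (1 +
        ENNReal.ofReal (16 * 2 ^ r) * ENNReal.ofReal (deltaFun r (Y 0 ω))) ∂P := by
      refine lintegral_mono fun ω => ?_
      rw [← ENNReal.ofReal_mul (by positivity), ← ENNReal.ofReal_one,
        ← ENNReal.ofReal_add zero_le_one (mul_nonneg (by positivity) (deltaFun_nonneg _ _))]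
      exact ENNReal.ofReal_le_ofReal (rpow_le_deltaFun hr _)
    refine h1.trans_lt ?_
    rw [lintegral_add_left measurable_const, lintegral_const_mul _ hδ]
    simp only [lintegral_const, measure_univ, mul_one]
    exact ENNReal.add_lt_top.2 ⟨ENNReal.one_lt_top, ENNReal.mul_lt_top ENNReal.ofReal_lt_top hlt⟩
  · exact fun hlt => (lintegral_mono fun ω =>
      ENNReal.ofReal_le_ofReal (deltaFun_le hr _)).trans_lt hlt

theorem tendsto_measure_displacement (hap : Aperiodic p) (q : ℤ → Prop) [DecidablePred q] :
    Tendsto (fun n : ℕ+ => (P {ω | q (displacement (Per ω) n)}).toReal) atTop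
      (𝓝 (limitMean P Y p (fun x => if q x then 1 else 0)).toReal) := by
  have h1 := h.tendsto_lintegral_displacement hμ hap (fun x => if q x then 1 else 0)
    (fun _ => 1) (by simp) (fun _ d _ => by split_ifs <;> simp)
  have hle : limitMean P Y p (fun x => if q x then 1 else 0) ≤ limitMean P Y p (fun _ => 1) := by
    unfold limitMean blockMean
    gcongr
    dsimp only
    split_ifs <;> simp
  rw [h.limitMean_one hμ] at hle
  refine ((ENNReal.tendsto_toReal (ne_top_of_le_ne_top ENNReal.one_ne_top hle)).comp h1).congr
    fun n => ?_
  simp only [Function.comp]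
  rw [lintegral_ite_eq_measure (h.measurable_displacement n)]

end IsRecurrentRegenerative

end RegenPerm

open RegenPerm in
theorem mainTheorem8 {Ω : Type*} [MeasurableSpace Ω] (P : Measure Ω) [IsProbabilityMeasure P]
    (Per : Ω → Equiv.Perm ℕ+) (T₀ : Ω → ℕ) (Y : ℕ → Ω → ℕ+) (p : PMF ℕ+)
    (hPer : IsRecurrentRegenerative P Per T₀ Y p
      (fun n => PMF.uniformOfFintype (Equiv.Perm (Fin n))))
    (hμ : meanLength p ≠ ⊤) :
    -- (i) cycle counts: the expected number of `j`-cycles in each block `k ≥ 1`, the almost sure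
    -- limits of `C_{n,j} / n` and of the relative frequencies of cycle lengths
    (∀ j : ℕ+,
      (P {ω | j ≤ Y 0 ω}).toReal = (∑' i : ℕ+, if j ≤ i then (p i).toReal else 0) ∧
      (∀ k : ℕ,
        ∫⁻ ω, (cycleCount (Per ω) (renewalTime T₀ Y k ω) (renewalTime T₀ Y (k + 1) ω) j : ℝ≥0∞) ∂P =
          P {ω | j ≤ Y 0 ω} / (j : ℝ≥0∞)) ∧
      (∀ᵐ ω ∂P, Tendsto (fun n : ℕ => (cycleCount (Per ω) 0 n j : ℝ) / n) atTop
        (𝓝 ((P {ω | j ≤ Y 0 ω}).toReal / (j : ℝ) / (meanLength p).toReal))) ∧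
      Summable (fun i : ℕ+ => (p i).toReal * (harmonic i : ℝ)) ∧
      (∀ᵐ ω ∂P, Tendsto
        (fun n : ℕ => (cycleCount (Per ω) 0 n j : ℝ) / (totalCycleCount (Per ω) 0 n : ℝ)) atTop
        (𝓝 ((∑' i : ℕ+, if j ≤ i then (p i).toReal else 0) /
          ((j : ℝ) * ∑' i : ℕ+, (p i).toReal * (harmonic i : ℝ)))))) ∧
    (Aperiodic p →
      -- (ii) the limit law of the displacements
      (∀ d : ℤ, Tendsto (fun n : ℕ+ => (P {ω | displacement (Per ω) n = d}).toReal) atTop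
        (𝓝 (1 / (meanLength p).toReal *
          ∫ ω, max ((Y 0 ω : ℝ) - |(d : ℝ)|) 0 / (Y 0 ω : ℝ) ∂P))) ∧
      HasSum (fun d : ℤ => 1 / (meanLength p).toReal *
          ∫ ω, max ((Y 0 ω : ℝ) - |(d : ℝ)|) 0 / (Y 0 ω : ℝ) ∂P) 1 ∧
      Tendsto (fun n : ℕ+ => (P {ω | n < Per ω n}).toReal) atTop
        (𝓝 (1 / 2 * (1 - 1 / (meanLength p).toReal))) ∧
      Tendsto (fun n : ℕ+ => (P {ω | Per ω n < n}).toReal) atTop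
        (𝓝 (1 / 2 * (1 - 1 / (meanLength p).toReal))) ∧
      -- (iii) the limits of the absolute moments
      (∀ r : ℝ, 0 < r → ∫⁻ ω, ENNReal.ofReal ((T₀ ω : ℝ) ^ r) ∂P < ⊤ →
        Tendsto (fun n : ℕ+ => ∫⁻ ω, ENNReal.ofReal (|(displacement (Per ω) n : ℝ)| ^ r) ∂P) atTop
          (𝓝 (2 / meanLength p * ∫⁻ ω, ENNReal.ofReal (deltaFun r (Y 0 ω)) ∂P))) ∧
      (∀ r : ℝ, 0 < r →
        (2 / meanLength p * ∫⁻ ω, ENNReal.ofReal (deltaFun r (Y 0 ω)) ∂P < ⊤ ↔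
          ∫⁻ ω, ENNReal.ofReal ((Y 0 ω : ℝ) ^ (r + 1)) ∂P < ⊤)) ∧
      -- (ii) and (iii) for the stationary version on `ℤ`
      (∀ {Ω' : Type*} [MeasurableSpace Ω'] (P' : Measure Ω') [IsProbabilityMeasure P']
        (StarPer : Ω' → Equiv.Perm ℤ) (Ren : Ω' → Set ℤ),
        IsStationaryVersion P Per T₀ Y p P' StarPer Ren → ∀ z : ℤ,
          (∀ d : ℤ, (P' {ω | StarPer ω z - z = d}).toReal = 1 / (meanLength p).toReal *
            ∫ ω, max ((Y 0 ω : ℝ) - |(d : ℝ)|) 0 / (Y 0 ω : ℝ) ∂P) ∧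
          (∀ d : ℤ, P' {ω | StarPer ω z - z = -d} = P' {ω | StarPer ω z - z = d}) ∧
          (P' {ω | 0 < StarPer ω z - z}).toReal = 1 / 2 * (1 - 1 / (meanLength p).toReal) ∧
          (P' {ω | StarPer ω z - z < 0}).toReal = 1 / 2 * (1 - 1 / (meanLength p).toReal) ∧
          (∀ r : ℝ, 0 < r →
            ∫⁻ ω, ENNReal.ofReal (|((StarPer ω z - z : ℤ) : ℝ)| ^ r) ∂P' =
              2 / meanLength p * ∫⁻ ω, ENNReal.ofReal (deltaFun r (Y 0 ω)) ∂P) ∧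
          (∀ r : ℝ, 0 < r →
            (∫⁻ ω, ENNReal.ofReal (|((StarPer ω z - z : ℤ) : ℝ)| ^ r) ∂P' < ⊤ ↔
              ∫⁻ ω, ENNReal.ofReal ((Y 0 ω : ℝ) ^ (r + 1)) ∂P < ⊤)))) ∧
    -- `δ_r` for integers `r ≥ 1` is a polynomial of degree `r + 1`
    (∀ r : ℕ, 1 ≤ r → ∃ q : Polynomial ℝ, q.natDegree = r + 1 ∧
      ∀ n : ℕ+, deltaFun r n = q.eval (n : ℝ)) ∧
    (∀ n : ℕ+, deltaFun 1 n = 1 / 6 * ((n : ℝ) ^ 2 - 1)) ∧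
    (∀ n : ℕ+, deltaFun 2 n = 1 / 12 * (n : ℝ) * ((n : ℝ) ^ 2 - 1)) := by
  refine ⟨fun j => hPer.cycle_limits hμ j, fun hap => ⟨fun d => ?_, hPer.hasSum_limit hμ, ?_, ?_,
    fun r hr hT => ?_, fun r hr => hPer.limitMean_lt_top_iff hμ hr, ?_⟩,
    fun r hr => exists_polynomial_deltaFun hr, deltaFun_one, deltaFun_two⟩
  · rw [← hPer.toReal_limitMean_single]
    exact hPer.tendsto_measure_displacement hμ hap (· = d)
  · rw [← hPer.toReal_limitMean_pos hμ]
    refine (hPer.tendsto_measure_displacement hμ hap (0 < ·)).congr fun n => ?_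
    simp only [displacement, sub_pos, Nat.cast_lt, PNat.coe_lt_coe]
  · rw [← hPer.toReal_limitMean_neg hμ]
    refine (hPer.tendsto_measure_displacement hμ hap (· < 0)).congr fun n => ?_
    simp only [displacement, sub_neg, Nat.cast_lt, PNat.coe_lt_coe]
  · rw [← hPer.limitMean_abs_rpow hr]
    refine hPer.tendsto_lintegral_displacement hμ hap _ (fun t => ENNReal.ofReal ((t : ℝ) ^ r))
      hT.ne fun t d hd => ENNReal.ofReal_le_ofReal (Real.rpow_le_rpow (abs_nonneg _) ?_ hr.le)
    exact_mod_cast hd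
  · intro Ω' _ P' _ StarPer Ren hS z
    have hlaw : ∀ φ : ℤ → ℝ≥0∞, ∫⁻ ω, φ (StarPer ω z - z) ∂P' = limitMean P Y p φ :=
      fun φ => hS.lintegral_displacement hPer hμ φ z
    have hmeas : Measurable fun ω => StarPer ω z - z := (hS.measurable_perm z).sub_const z
    have hprob : ∀ (q : ℤ → Prop) [DecidablePred q], P' {ω | q (StarPer ω z - z)} =
        limitMean P Y p (fun x => if q x then 1 else 0) := fun q _ => by
      rw [← hlaw, lintegral_ite_eq_measure hmeas]
    refine ⟨fun d => ?_, fun d => ?_, ?_, ?_, fun r hr => ?_, fun r hr => ?_⟩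
    · rw [← hPer.toReal_limitMean_single, ← hprob (· = d)]
    · rw [hprob (· = -d), hprob (· = d), limitMean_neg_single]
    · rw [← hPer.toReal_limitMean_pos hμ, ← hprob (0 < ·)]
    · rw [← hPer.toReal_limitMean_neg hμ, ← hprob (· < 0)]
    · rw [hlaw fun x => ENNReal.ofReal (|(x : ℝ)| ^ r), hPer.limitMean_abs_rpow hr]
    · rw [hlaw fun x => ENNReal.ofReal (|(x : ℝ)| ^ r), hPer.limitMean_abs_rpow hr,
        hPer.limitMean_lt_top_iff hμ hr]
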